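/- Let $d\ge 3$, let $W\subset\mathbb R^d$ be a compact convex set of volume one, and let $L\subset\mathbb R^d$ be a two-dimensional linear subspace. For $x\in\mathbb R^d$ and $A\subset\mathbb R^d$ write $x|_L$, $A|_L$ for the orthogonal projections onto $L$, and $[v,w]$ for the line segment between $v$ and $w$. For every $t>0$ let $\delta_t>0$, let $\eta_t$ be a Poisson point process with intensity measure $t\,\lambda_d(\,\cdot\,\cap W)$ ($\lambda_d$ the Lebesgue measure), and let $V_t$ be its set of points. Let $S_t$ be the set of all quadruples $(v_1,v_2,w_1,w_2)$ of pairwise distinct points of $V_t$ with $\|v_1-v_2\|\le\delta_t$, $\|w_1-w_2\|\le\delta_t$ and $[v_1,v_2]|_L\cap[w_1,w_2]|_L\ne\emptyset$, and let $$\xi_t=\frac18\sum_{(v_1,v_2,w_1,w_2)\in S_t}\delta_{[v_1,v_2]|_L\cap[w_1,w_2]|_L}$$ be the point process of crossings in the projection onto $L$ of the random geometric graph on $V_t$ with radius $\delta_t$ (here $\delta_{\{x\}}$ denotes the unit mass at $x$), so that $\xi_t(L)$ is the crossing number. Suppose that $t^2\delta_t^{d+1}\to c$ as $t\to\infty$ for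 some $c\in\mathbb R$ (necessarily $c\ge 0$). Then $\xi_t(L)$ is almost surely finite and square integrable for every $t>0$, and $$\operatorname{Var}\xi_t(L)-\mathbb E\,\xi_t(L)=\mathcal O(\delta_t)\qquad(t\to\infty),$$ that is, there are $M>0$ and $t_0>0$ with $|\operatorname{Var}\xi_t(L)-\mathbb E\,\xi_t(L)|\le M\delta_t$ for all $t\ge t_0$. -/

import Mathlib

open MeasureTheory ProbabilityTheory Set Filter Asymptotics
open scoped ENNReal NNReal Topology

/-- A point measure: a countable sum of unit masses (points may repeat). -/
def IsPointMeasure {E : Type*} [MeasurableSpace E] (m : Measure E) : Prop :=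
  ∃ (ι : Type) (_ : Countable ι) (x : ι → E), m = Measure.sum (fun i => Measure.dirac (x i))

/-- `η` is a Poisson point process with (`σ`-finite) intensity measure `μ` on the probability
space `(Ω, P)`: a random point measure whose number of points in a measurable set `B` of finite
`μ`-measure is Poisson distributed with parameter `μ B`, and whose numbers of points in pairwise
disjoint measurable sets are independent. -/
structure IsPoissonPointProcess {Ω E : Type*} [MeasurableSpace Ω] [MeasurableSpace E]
    (P : Measure Ω) (η : Ω → Measure E) (μ : Measure E) : Prop where
  isPointMeasure : ∀ ω, IsPointMeasure (η ω)
  measurable : Measurable η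
  map_eq_poisson : ∀ B : Set E, MeasurableSet B → μ B ≠ ∞ →
    P.map (fun ω => η ω B) = (poissonMeasure (μ B).toNNReal).map (fun n : ℕ => (n : ℝ≥0∞))
  indep : ∀ (n : ℕ) (B : Fin n → Set E), (∀ i, MeasurableSet (B i)) →
    Pairwise (fun i j => Disjoint (B i) (B j)) → iIndepFun (fun i ω => η ω (B i)) P

/-- The points charged by a measure; for a finite point measure, this is its support. -/
def pointSet {E : Type*} [MeasurableSpace E] (m : Measure E) : Set E := {x | m {x} ≠ 0}

section Crossings

variable {d : ℕ}

/-- The orthogonal projection `[v, w]|_L` of the segment `[v, w]` onto the subspace `L`. -/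
def projSegment (L : Submodule ℝ (EuclideanSpace ℝ (Fin d)))
    (v w : EuclideanSpace ℝ (Fin d)) : Set L :=
  (fun x => L.orthogonalProjectionOnto x) '' segment ℝ v w

/-- The ordered quadruples `(v₁, v₂, w₁, w₂)` of pairwise distinct points of `V` such that
`{v₁, v₂}` and `{w₁, w₂}` are edges of the geometric graph on `V` with radius `δ` which cross in
the projection onto `L`. -/
def crossingQuadruples (L : Submodule ℝ (EuclideanSpace ℝ (Fin d))) (δ : ℝ)
    (V : Set (EuclideanSpace ℝ (Fin d))) : Set (Fin 4 → EuclideanSpace ℝ (Fin d)) :=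
  {q | (∀ i, q i ∈ V) ∧ Function.Injective q ∧ ‖q 0 - q 1‖ ≤ δ ∧ ‖q 2 - q 3‖ ≤ δ ∧
    (projSegment L (q 0) (q 1) ∩ projSegment L (q 2) (q 3)).Nonempty}

/-- The point of `L` where the two projected edges of a crossing quadruple meet (some common
point, if the projected edges overlap in more than one point). -/
noncomputable def crossingPoint (L : Submodule ℝ (EuclideanSpace ℝ (Fin d))) (δ : ℝ)
    (V : Set (EuclideanSpace ℝ (Fin d))) (q : crossingQuadruples L δ V) : L :=
  q.2.2.2.2.2.some

/-- The crossing measure `ξ = (1/8) ∑ δ_{[v₁,v₂]|_L ∩ [w₁,w₂]|_L}` on `L`, the sum being over all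
crossing quadruples. -/
noncomputable def crossingMeasure (L : Submodule ℝ (EuclideanSpace ℝ (Fin d))) (δ : ℝ)
    (V : Set (EuclideanSpace ℝ (Fin d))) : Measure L :=
  (8 : ℝ≥0∞)⁻¹ • Measure.sum (fun q : crossingQuadruples L δ V =>
    Measure.dirac (crossingPoint L δ V q))

end Crossings

/-!
The number `ξ(L)` of crossings is one eighth of the number `N` of quadruples of distinct points of
the process that belong to the closed set `crossingSet L δ`. All moments come from one formula
(`IsPoissonPointProcess.aemeasurable_and_lintegral_distinctTuples`): for a Poisson process with
finite diffuse intensity `μ`, the expected number of `k`-tuples of distinct points in a measurable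
set `B` is the `k`-fold product measure of `B`.

The square `N ^ 2` counts pairs of quadruples (`encard_sq_distinctTuples_crossingSet`). Pairs
without common points have expected number `(E N) ^ 2`. Each quadruple is paired with the eight
reorderings of itself that describe the same crossing, which gives `8 E N`. All other pairs overlap;
if `R` is their number, then `Var ξ(L) - E ξ(L) = E R / 64`
(`IsPoissonPointProcess.variance_crossings`), and it remains to show `E R = O(δ)`.

The points of an overlapping pair are the vertices of a tree in which each vertex but the first
lies in a ball of radius `3 δ` around its parent, of measure `O(δ ^ d)`, or in a cylinder of radius
`4 δ` around its parent orthogonal to `L`, of measure `O(δ ^ 2)` within the bounded set `W`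
(`exists_mem_treePairs_of_overlap`). A tree with `n` edges, `c` of them of cylinder type, has an
expected number of occurrences of order `t ^ (n + 1) δ ^ (d (n - c) + 2 c)`. The two crossings
together span a tree with `(n, c)` one of

* `(3, 0)`, if they have the same four points: points paired in two ways are all close together;
* `(4, 1)`, if one point of the second crossing is new;
* `(5, 2)` or `(5, 1)`, if two points are new and do or do not form an edge;
* `(6, 2)`, if three points are new.

In each case, the bound on `t ^ 2 δ ^ (d + 1)` and `d ≥ 3` turn this into `O(δ)`
(`sparse_weight_le`).
-/

universe u v

/-! ### Poisson processes with diffuse intensity are simple -/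

theorem lintegral_natCast_poissonMeasure (r : ℝ≥0) :
    ∫⁻ n, (n : ℝ≥0∞) ∂(poissonMeasure r) = r := by
  rw [poissonMeasure, lintegral_sum_measure]
  simp only [lintegral_smul_measure, lintegral_dirac, smul_eq_mul]
  rw [tsum_eq_zero_add' ENNReal.summable]
  simp only [Nat.cast_zero, mul_zero, zero_add]
  have h : ∀ n : ℕ, ENNReal.ofReal (Real.exp (-r) * r ^ (n + 1) / (n + 1).factorial) *
      ((n + 1 : ℕ) : ℝ≥0∞) = r * ENNReal.ofReal (Real.exp (-r) * r ^ n / n.factorial) := by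
    intro n
    rw [← ENNReal.ofReal_natCast, ← ENNReal.ofReal_coe_nnreal,
      ← ENNReal.ofReal_mul (by positivity), ← ENNReal.ofReal_mul (by positivity)]
    congr 1
    rw [Nat.factorial_succ]
    push_cast
    have : (n.factorial : ℝ) ≠ 0 := by positivity
    have : ((n : ℝ) + 1) ≠ 0 := by positivity
    field_simp
    ring
  simp_rw [h]
  rw [ENNReal.tsum_mul_left, ← ENNReal.ofReal_tsum_of_nonneg (fun n => by positivity)
    (hasSum_one_poissonMeasure r).summable, (hasSum_one_poissonMeasure r).tsum_eq]
  simp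

/-- The mean is the sum of the tail probabilities, so `P(N ≥ 2) ≤ E N - P(N ≥ 1)`. -/
theorem poissonMeasure_two_le (r : ℝ≥0) :
    (poissonMeasure r) {n | 2 ≤ n} ≤ (r : ℝ≥0∞) ^ 2 := by
  have h1 : poissonMeasure r {n | 1 ≤ n} = ENNReal.ofReal (1 - Real.exp (-r)) := by
    have : {n : ℕ | 1 ≤ n} = {0}ᶜ := by
      ext n; simp [Nat.one_le_iff_ne_zero]
    rw [this, prob_compl_eq_one_sub (measurableSet_singleton 0), poissonMeasure_singleton]
    simp only [pow_zero, mul_one, Nat.factorial_zero, Nat.cast_one, div_one]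
    rw [ENNReal.ofReal_sub _ (Real.exp_pos _).le, ENNReal.ofReal_one]
  have h2 : (poissonMeasure r) {n | 2 ≤ n} + (poissonMeasure r) {n | 1 ≤ n} ≤ r := by
    rw [← lintegral_natCast_poissonMeasure r, ← lintegral_indicator_one .of_discrete,
      ← lintegral_indicator_one .of_discrete, ← lintegral_add_left .of_discrete]
    refine lintegral_mono fun n => ?_
    rcases n with _ | _ | n
    · simp
    · simp
    · simp [indicator]
  rw [h1] at h2
  have h3 : (r : ℝ≥0∞) ≤ (r : ℝ≥0∞) ^ 2 + ENNReal.ofReal (1 - Real.exp (-r)) := by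
    have h4 : Real.exp (-r) ≤ 1 := Real.exp_le_one_iff.2 (by simp)
    rw [← ENNReal.ofReal_coe_nnreal, ← ENNReal.ofReal_pow (by simp),
      ← ENNReal.ofReal_add (by positivity) (by linarith)]
    refine ENNReal.ofReal_le_ofReal ?_
    have h0 : (0 : ℝ) ≤ r := r.2
    rcases le_or_gt (r : ℝ) 1 with h | h
    · have h5 := Real.abs_exp_sub_one_sub_id_le (x := -(r : ℝ))
        (by rw [abs_neg, abs_of_nonneg h0]; exact h)
      have := (abs_le.1 h5).2
      nlinarith
    · nlinarith
  exact ENNReal.le_of_add_le_add_right (by simp) (h2.trans h3)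

section Poisson

variable {Ω E : Type*} [MeasurableSpace Ω] [MeasurableSpace E] {P : Measure Ω}
  {η : Ω → Measure E} {μ : Measure E}

theorem IsPoissonPointProcess.measurable_apply (h : IsPoissonPointProcess P η μ) {B : Set E}
    (hB : MeasurableSet B) : Measurable fun ω => η ω B :=
  (Measure.measurable_coe hB).comp h.measurable

theorem IsPoissonPointProcess.lintegral_apply [IsFiniteMeasure μ]
    (h : IsPoissonPointProcess P η μ) {B : Set E} (hB : MeasurableSet B) :
    ∫⁻ ω, η ω B ∂P = μ B := by
  have h1 := lintegral_map (μ := P) (f := fun x : ℝ≥0∞ => x) measurable_id (h.measurable_apply hB)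
  rw [← h1, h.map_eq_poisson B hB (measure_ne_top _ _),
    lintegral_map (f := fun x : ℝ≥0∞ => x) measurable_id .of_discrete,
    lintegral_natCast_poissonMeasure, ENNReal.coe_toNNReal (measure_ne_top _ _)]

theorem IsPoissonPointProcess.measure_two_le [IsFiniteMeasure μ]
    (h : IsPoissonPointProcess P η μ) {B : Set E} (hB : MeasurableSet B) :
    P {ω | 2 ≤ η ω B} ≤ μ B ^ 2 := by
  have h1 : P {ω | 2 ≤ η ω B} = P.map (fun ω => η ω B) (Ici 2) := by
    rw [Measure.map_apply (h.measurable_apply hB) measurableSet_Ici]; rfl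
  rw [h1, h.map_eq_poisson B hB (measure_ne_top _ _),
    Measure.map_apply .of_discrete measurableSet_Ici]
  have h2 : (fun n : ℕ => (n : ℝ≥0∞)) ⁻¹' Ici 2 = {n | 2 ≤ n} := by
    ext n
    simp only [mem_preimage, mem_Ici, mem_ofPred_eq]
    exact_mod_cast Iff.rfl
  rw [h2]
  refine (poissonMeasure_two_le _).trans ?_
  rw [ENNReal.coe_toNNReal (measure_ne_top _ _)]

theorem IsPoissonPointProcess.ae_univ_ne_top [IsFiniteMeasure μ]
    (h : IsPoissonPointProcess P η μ) : ∀ᵐ ω ∂P, η ω univ ≠ ∞ := by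
  have := ae_lt_top (h.measurable_apply MeasurableSet.univ)
    (by rw [h.lintegral_apply MeasurableSet.univ]; exact measure_ne_top _ _)
  filter_upwards [this] with ω hω using hω.ne

end Poisson

/-- A finite diffuse measure admits countable measurable partitions into sets of arbitrarily small
measure. -/
theorem exists_partition_measure_le {E : Type*} [TopologicalSpace E] [SecondCountableTopology E]
    [T1Space E] [MeasurableSpace E] [BorelSpace E] [Nonempty E]
    (μ : Measure E) [IsFiniteMeasure μ] [NullSingletonClass μ] [μ.OuterRegular]
    {ε : ℝ≥0∞} (hε : ε ≠ 0) :
    ∃ C : ℕ → Set E, (∀ n, MeasurableSet (C n)) ∧ Pairwise (Function.onFun Disjoint C) ∧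
      ⋃ n, C n = univ ∧ ∀ n, μ (C n) ≤ ε := by
  have h1 : ∀ x : E, ∃ U, x ∈ U ∧ IsOpen U ∧ μ U < ε := by
    intro x
    obtain ⟨U, hU, hU2, hU3⟩ := ({x} : Set E).exists_isOpen_lt_of_lt (μ := μ) ε
      (by simpa using pos_iff_ne_zero.2 hε)
    exact ⟨U, by simpa using hU, hU2, hU3⟩
  choose U hxU hU hUε using h1
  obtain ⟨T, hT, hT2⟩ := TopologicalSpace.isOpen_iUnion_countable U hU
  have hun : ⋃ i, U i = univ := eq_univ_of_forall fun x => mem_iUnion.2 ⟨x, hxU x⟩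
  rw [hun] at hT2
  have hTne : T.Nonempty := by
    by_contra h
    rw [not_nonempty_iff_eq_empty] at h
    subst h
    simp [empty_ne_univ] at hT2
  obtain ⟨f, hf⟩ := hT.exists_eq_range hTne
  refine ⟨disjointed fun n => U (f n), fun n => ?_, disjoint_disjointed _, ?_, fun n => ?_⟩
  · exact MeasurableSet.disjointed (fun n => (hU _).measurableSet) n
  · rw [iUnion_disjointed, ← hT2, hf, biUnion_range]
  · exact (measure_mono (disjointed_subset _ _)).trans (hUε _).le

section Simple

variable {Ω E : Type*} [MeasurableSpace Ω] [TopologicalSpace E] [SecondCountableTopology E]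
  [T1Space E] [MeasurableSpace E] [BorelSpace E] {P : Measure Ω}
  {η : Ω → Measure E} {μ : Measure E}

/-- A Poisson process with diffuse intensity has no multiple points: in a partition into cells of
measure at most `ε`, the probability that some cell contains two points is at most `ε μ(E)`. -/
theorem IsPoissonPointProcess.ae_simple [IsFiniteMeasure μ] [NullSingletonClass μ] [μ.OuterRegular]
    (h : IsPoissonPointProcess P η μ) : ∀ᵐ ω ∂P, ∀ x, η ω {x} < 2 := by
  rcases isEmpty_or_nonempty E with hE | hE
  · exact ae_of_all _ fun ω x => (hE.false x).elim
  rw [ae_iff]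
  have key : ∀ ε : ℝ≥0∞, ε ≠ 0 → P {ω | ¬ ∀ x, η ω {x} < 2} ≤ ε * μ univ := by
    intro ε hε
    obtain ⟨C, hC, hd, hun, hε'⟩ := exists_partition_measure_le μ hε
    calc P {ω | ¬ ∀ x, η ω {x} < 2} ≤ P (⋃ n, {ω | 2 ≤ η ω (C n)}) := by
          refine measure_mono fun ω hω => ?_
          simp only [mem_ofPred_eq, not_forall, not_lt] at hω
          obtain ⟨x, hx⟩ := hω
          obtain ⟨n, hn⟩ := mem_iUnion.1 (hun ▸ mem_univ x : x ∈ ⋃ n, C n)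
          exact mem_iUnion.2 ⟨n, hx.trans (measure_mono (singleton_subset_iff.2 hn))⟩
      _ ≤ ∑' n, P {ω | 2 ≤ η ω (C n)} := measure_iUnion_le _
      _ ≤ ∑' n, ε * μ (C n) := by
          refine ENNReal.tsum_le_tsum fun n => (h.measure_two_le (hC n)).trans ?_
          rw [sq]
          gcongr
          exact hε' n
      _ = ε * μ univ := by
          rw [ENNReal.tsum_mul_left, ← measure_iUnion hd hC, hun]
  refine le_antisymm (ENNReal.le_of_forall_pos_le_add fun ε hε _ => ?_) bot_le
  rw [zero_add]
  refine (key (ε / (μ univ + 1)) ?_).trans ?_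
  · simp [hε.ne']
  · rw [mul_comm, ← mul_div_assoc, mul_comm, mul_div_assoc]
    refine mul_le_of_le_one_right' ?_
    exact ENNReal.div_le_of_le_mul (by simp)

end Simple

/-- A finite point measure without multiple points counts the points it charges. -/
theorem IsPointMeasure.finite_and_apply_eq_encard {E : Type*} [MeasurableSpace E]
    [MeasurableSingletonClass E] {m : Measure E}
    (hm : IsPointMeasure m) (hfin : m univ ≠ ∞) (hs : ∀ x, m {x} < 2) :
    (pointSet m).Finite ∧ ∀ A, MeasurableSet A → m A = ((A ∩ pointSet m).encard : ℝ≥0∞) := by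
  obtain ⟨ι, _, x, rfl⟩ := hm
  have happ : ∀ A, MeasurableSet A → Measure.sum (fun i => Measure.dirac (x i)) A =
      ((x ⁻¹' A).encard : ℝ≥0∞) := by
    intro A hA
    rw [Measure.sum_apply _ hA, ← ENNReal.tsum_set_one,
      tsum_subtype (x ⁻¹' A) (fun _ => (1 : ℝ≥0∞))]
    congr 1 with i
    rw [Measure.dirac_apply' _ hA]
    by_cases hi : x i ∈ A <;> simp [hi]
  have hι : Finite ι := by
    rw [happ _ MeasurableSet.univ] at hfin
    rw [preimage_univ] at hfin
    have : (univ : Set ι).encard ≠ ⊤ := by simpa using hfin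
    exact finite_univ_iff.1 (encard_ne_top_iff.1 this)
  have hps : pointSet (Measure.sum (fun i => Measure.dirac (x i))) = range x := by
    ext y
    rw [pointSet, mem_ofPred_eq, happ _ (measurableSet_singleton y)]
    simp [Set.eq_empty_iff_forall_notMem]
  have hinj : Function.Injective x := by
    intro i j hij
    by_contra hne
    have h2 := hs (x i)
    rw [happ _ (measurableSet_singleton _)] at h2
    have h3 : (2 : ℕ∞) ≤ (x ⁻¹' {x i}).encard := by
      rw [← encard_pair hne]
      refine encard_le_encard ?_
      rintro k (rfl | rfl)
      · simp
      · simp [hij]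
    exact absurd (ENat.toENNReal_mono h3) (not_le.2 (by simpa using h2))
  rw [hps]
  refine ⟨finite_range x, fun A hA => ?_⟩
  rw [happ A hA, ← image_preimage_eq_inter_range, hinj.encard_image]

/-! ### Factorial moment measures of a Poisson process -/

section Update

theorem measurableSet_injective {ι E : Type*} [Fintype ι] [MeasurableSpace E] [MeasurableEq E] :
    MeasurableSet {q : ι → E | Function.Injective q} := by
  have : {q : ι → E | Function.Injective q} = ⋂ i, ⋂ j, {q | q i = q j → i = j} := by
    ext q; simp [Function.Injective]
  rw [this]
  refine MeasurableSet.iInter fun i => MeasurableSet.iInter fun j => ?_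
  exact (measurableSet_eq_fun (measurable_pi_apply i) (measurable_pi_apply j)).imp
    (MeasurableSet.const _)

variable {ι E : Type*} [Fintype ι] [DecidableEq ι] [MeasurableSpace E]

/-- Resampling one coordinate of a product measure gives back the product measure, up to the
total mass of the factor. -/
theorem map_update_pi_prod (μ : Measure E) [IsFiniteMeasure μ] (i : ι) :
    ((Measure.pi fun _ : ι => μ).prod μ).map (fun p : (ι → E) × E => Function.update p.1 i p.2) =
      μ univ • Measure.pi fun _ : ι => μ := by
  have hmeas : Measurable (fun p : (ι → E) × E => Function.update p.1 i p.2) := measurable_update'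
  have h : ∀ s : ι → Set E, (∀ j, MeasurableSet (s j)) →
      ((Measure.pi fun _ : ι => μ).prod μ).map
        (fun p : (ι → E) × E => Function.update p.1 i p.2) (univ.pi s) =
      μ univ * ∏ j, μ (s j) := by
    intro s hs
    have hpre : (fun p : (ι → E) × E => Function.update p.1 i p.2) ⁻¹' univ.pi s =
        (univ.pi (Function.update s i univ)) ×ˢ s i := by
      ext ⟨r, y⟩
      simp only [mem_preimage, Set.mem_pi, mem_univ, true_imp_iff, mem_prod]
      constructor
      · intro h
        refine ⟨fun j => ?_, by simpa using h i⟩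
        by_cases hj : j = i
        · subst hj; simp
        · simpa [hj] using h j
      · rintro ⟨h1, h2⟩ j
        by_cases hj : j = i
        · subst hj; simpa using h2
        · simpa [hj] using h1 j
    rw [Measure.map_apply hmeas (MeasurableSet.univ_pi hs), hpre, Measure.prod_prod, Measure.pi_pi,
      ← Finset.mul_prod_erase _ _ (Finset.mem_univ i),
      ← Finset.mul_prod_erase _ (fun j => μ (s j)) (Finset.mem_univ i)]
    rw [Finset.prod_congr rfl (g := fun j => μ (s j)) fun j hj => by
      rw [Function.update_of_ne (Finset.ne_of_mem_erase hj)]]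
    simp only [Function.update_self]
    ring
  by_cases h0 : μ univ = 0
  · have hz : μ = 0 := Measure.measure_univ_eq_zero.1 h0
    subst hz
    simp
  have h2 : Measure.pi (fun _ : ι => μ) = (μ univ)⁻¹ •
      ((Measure.pi fun _ : ι => μ).prod μ).map
        (fun p : (ι → E) × E => Function.update p.1 i p.2) := by
    refine Measure.pi_eq fun s hs => ?_
    rw [Measure.smul_apply, h s hs, smul_eq_mul, ← mul_assoc,
      ENNReal.inv_mul_cancel h0 (measure_ne_top _ _), one_mul]
  rw [h2, smul_smul, ENNReal.mul_inv_cancel h0 (measure_ne_top _ _), one_smul, ← h2]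

/-- If membership in `S` does not depend on the coordinate `i`, and the section of `C` in that
coordinate has measure at most `a`, then imposing `C` costs a factor `a`. -/
theorem pi_inter_le_mul (μ : Measure E) [IsFiniteMeasure μ] (i : ι) {S C : Set (ι → E)}
    (hS : MeasurableSet S) (hC : MeasurableSet C)
    (hSi : ∀ r y, Function.update r i y ∈ S ↔ r ∈ S) {a : ℝ≥0∞}
    (ha : ∀ r, μ {y | Function.update r i y ∈ C} ≤ a) :
    μ univ * (Measure.pi fun _ : ι => μ) (S ∩ C) ≤ a * (Measure.pi fun _ : ι => μ) S := by
  have hmeas : Measurable (fun p : (ι → E) × E => Function.update p.1 i p.2) := measurable_update'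
  rw [← smul_eq_mul, ← Measure.smul_apply, ← map_update_pi_prod μ i,
    Measure.map_apply hmeas (hS.inter hC), Measure.prod_apply (hmeas (hS.inter hC)),
    ← lintegral_indicator_const hS]
  refine lintegral_mono fun r => ?_
  by_cases hr : r ∈ S
  · rw [indicator_of_mem hr]
    refine le_trans (measure_mono ?_) (ha r)
    intro y hy
    exact hy.2
  · rw [indicator_of_notMem hr]
    refine (measure_mono_null ?_ (measure_empty (μ := μ))).le
    intro y hy
    exact hr ((hSi r y).1 hy.1)

theorem pi_diagonal_eq_zero [MeasurableEq E] (μ : Measure E) [IsFiniteMeasure μ]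
    [NullSingletonClass μ] {i j : ι} (hij : i ≠ j) :
    (Measure.pi fun _ : ι => μ) {q | q i = q j} = 0 := by
  by_cases h0 : μ univ = 0
  · have hz : μ = 0 := Measure.measure_univ_eq_zero.1 h0
    have : (Measure.pi fun _ : ι => μ) univ = 0 := by
      rw [Measure.pi_univ]
      exact Finset.prod_eq_zero (Finset.mem_univ i) h0
    exact measure_mono_null (subset_univ _) this
  have h := pi_inter_le_mul μ i (S := univ) (C := {q : ι → E | q i = q j}) MeasurableSet.univ
    (measurableSet_eq_fun (measurable_pi_apply i) (measurable_pi_apply j)) (by simp) (a := 0) (by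
      intro r
      simp [hij.symm])
  simpa [h0] using h

theorem ae_injective_pi [MeasurableEq E] (μ : Measure E) [IsFiniteMeasure μ]
    [NullSingletonClass μ] : ∀ᵐ q ∂(Measure.pi fun _ : ι => μ), Function.Injective q := by
  have : ∀ᵐ q ∂(Measure.pi fun _ : ι => μ), ∀ i j : ι, i ≠ j → q i ≠ q j := by
    refine ae_all_iff.2 fun i => ae_all_iff.2 fun j => ?_
    by_cases hij : i = j
    · exact ae_of_all _ fun q h => (h hij).elim
    · refine ae_iff.2 ?_
      simpa [hij] using pi_diagonal_eq_zero μ hij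
  filter_upwards [this] with q hq i j h
  by_contra hij
  exact hq i j hij h

end Update

/-- The tuples of pairwise distinct points of `V` that belong to `B`. -/
def distinctTuples {ι E : Type*} (V : Set E) (B : Set (ι → E)) : Set (ι → E) :=
  {q | q ∈ B ∧ Function.Injective q ∧ ∀ i, q i ∈ V}

section Moment

theorem toENNReal_encard_univ_pi {ι E : Type*} [Fintype ι] (s : ι → Set E) :
    ((univ.pi s).encard : ℝ≥0∞) = ∏ i, ((s i).encard : ℝ≥0∞) := by
  rw [encard_pi_eq_prod_encard]
  exact map_prod ENat.toENNRealRingHom _ _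

variable {ι E : Type*} [Fintype ι] [MeasurableSpace E] [MeasurableSingletonClass E]
  {Ω : Type*} [MeasurableSpace Ω]

/-- If the numbers of points of the random finite set `V` in measurable sets are measurable, then
so is the random counting measure of the tuples of points of `V`. -/
theorem measurable_count_restrict_pi {V : Ω → Set E} (hV : ∀ ω, (V ω).Finite)
    (hmeas : ∀ A, MeasurableSet A → Measurable fun ω => ((A ∩ V ω).encard : ℝ≥0∞)) :
    Measurable fun ω => (Measure.count : Measure (ι → E)).restrict (univ.pi fun _ => V ω) := by
  have hfin : ∀ ω, (univ.pi fun _ : ι => V ω).Finite := fun ω => Set.Finite.pi fun _ => hV ω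
  have hbox : ∀ s : ι → Set E, (∀ i, MeasurableSet (s i)) → Measurable fun ω =>
      (Measure.count : Measure (ι → E)).restrict (univ.pi fun _ => V ω) (univ.pi s) := by
    intro s hs
    have : ∀ ω, (Measure.count : Measure (ι → E)).restrict (univ.pi fun _ => V ω) (univ.pi s) =
        ∏ i, ((s i ∩ V ω).encard : ℝ≥0∞) := by
      intro ω
      rw [Measure.restrict_apply (MeasurableSet.univ_pi hs), ← pi_inter_distrib,
        Measure.count_apply, toENNReal_encard_univ_pi]
      exact ((hfin ω).subset (pi_mono fun i _ => inter_subset_right)).measurableSet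
    simp_rw [this]
    exact Finset.measurable_prod _ fun i _ => hmeas _ (hs i)
  have : ∀ ω, IsFiniteMeasure
      ((Measure.count : Measure (ι → E)).restrict (univ.pi fun _ => V ω)) := by
    intro ω
    refine ⟨?_⟩
    rw [Measure.restrict_apply_univ, Measure.count_apply_lt_top]
    exact hfin ω
  refine Measurable.measure_of_isPiSystem generateFrom_pi.symm isPiSystem_pi ?_ ?_
  · rintro _ ⟨s, hs, rfl⟩
    exact hbox s fun i => hs i (mem_univ i)
  · simpa using hbox (fun _ => univ) fun _ => MeasurableSet.univ

end Moment

section FactorialMoment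

/-- The product of the counts in disjoint sets has the product of the intensities as its mean. -/
theorem IsPoissonPointProcess.lintegral_prod_apply {Ω E : Type*} [MeasurableSpace Ω]
    [MeasurableSpace E] {P : Measure Ω} {η : Ω → Measure E} {μ : Measure E} [IsFiniteMeasure μ]
    {ι : Type*} [Fintype ι]
    (h : IsPoissonPointProcess P η μ) {B : ι → Set E} (hB : ∀ i, MeasurableSet (B i))
    (hd : Pairwise fun i j => Disjoint (B i) (B j)) :
    ∫⁻ ω, ∏ i, η ω (B i) ∂P = ∏ i, μ (B i) := by
  have e := Fintype.equivFin ι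
  have h1 := h.indep _ (fun k => B (e.symm k)) (fun k => hB _)
    (fun a b hab => hd (e.symm.injective.ne hab))
  have h2 := h1.precomp e.injective
  simp only [Equiv.symm_apply_apply] at h2
  rw [lintegral_prod_eq_prod_lintegral_of_indepFun Finset.univ _ h2 fun i =>
    h.measurable_apply (hB i)]
  exact Finset.prod_congr rfl fun i _ => h.lintegral_apply (hB i)

variable {Ω E : Type*} [MeasurableSpace Ω] [TopologicalSpace E] [SecondCountableTopology E]
  [T2Space E] [MeasurableSpace E] [BorelSpace E] {P : Measure Ω}
  {η : Ω → Measure E} {μ : Measure E}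

/-- Away from the diagonals, the space of tuples is covered by countably many boxes whose sides
are pairwise disjoint. -/
theorem exists_countable_disjoint_boxes (ι : Type u) [Fintype ι] (E : Type v) [TopologicalSpace E]
    [SecondCountableTopology E] [T2Space E] [MeasurableSpace E] [BorelSpace E] :
    ∃ (κ : Type (max u v)) (_ : Countable κ) (s : κ → ι → Set E), (∀ k i, MeasurableSet (s k i)) ∧
      (∀ k, Pairwise fun i j => Disjoint (s k i) (s k j)) ∧
      {q : ι → E | Function.Injective q} = ⋃ k, univ.pi (s k) := by
  classical
  let b := TopologicalSpace.countableBasis E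
  have : Countable b := (TopologicalSpace.countable_countableBasis E).to_subtype
  refine ⟨{f : ι → b // Pairwise fun i j => Disjoint (f i).1 (f j).1}, inferInstance,
    fun f i => (f.1 i).1, fun f i => ?_, fun f => f.2, ?_⟩
  · exact (TopologicalSpace.isOpen_of_mem_countableBasis (f.1 i).2).measurableSet
  · ext q
    simp only [mem_ofPred_eq, mem_iUnion, Set.mem_pi, mem_univ, true_imp_iff]
    constructor
    · intro hq
      obtain ⟨U, hU, hd⟩ := (finite_range q).t2_separation
      have : ∀ i, ∃ v ∈ b, q i ∈ v ∧ v ⊆ U (q i) := fun i =>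
        (TopologicalSpace.isBasis_countableBasis E).exists_subset_of_mem_open (hU _).1 (hU _).2
      choose v hvb hqv hvU using this
      refine ⟨⟨fun i => ⟨v i, hvb i⟩, fun i j hij => ?_⟩, hqv⟩
      exact (hd (mem_range_self i) (mem_range_self j) (hq.ne hij)).mono (hvU i) (hvU j)
    · rintro ⟨f, hf⟩ i j hij
      by_contra hne
      exact disjoint_left.1 (f.2 hne) (hf i) (hij ▸ hf j)

/-- The factorial moment measures of a Poisson process with finite diffuse intensity `μ` are the
powers of `μ`: both measures agree on boxes with disjoint sides, which cover all tuples of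
distinct points, and give no mass to the diagonals. -/
theorem IsPoissonPointProcess.aemeasurable_and_lintegral_distinctTuples [IsFiniteMeasure μ]
    [NullSingletonClass μ] [μ.OuterRegular] {ι : Type*} [Fintype ι]
    (h : IsPoissonPointProcess P η μ) {B : Set (ι → E)} (hB : MeasurableSet B) :
    AEMeasurable (fun ω => ((distinctTuples (pointSet (η ω)) B).encard : ℝ≥0∞)) P ∧
      ∫⁻ ω, ((distinctTuples (pointSet (η ω)) B).encard : ℝ≥0∞) ∂P =
        (Measure.pi fun _ : ι => μ) B := by
  classical
  have hgood : ∀ᵐ ω ∂P, (pointSet (η ω)).Finite ∧ ∀ A, MeasurableSet A →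
      η ω A = ((A ∩ pointSet (η ω)).encard : ℝ≥0∞) := by
    filter_upwards [h.ae_univ_ne_top, h.ae_simple] with ω h1 h2
    exact (h.isPointMeasure ω).finite_and_apply_eq_encard h1 h2
  obtain ⟨G, hGsub, hGm, hG0⟩ := exists_measurable_superset_of_null (ae_iff.1 hgood)
  -- On a null set, the point set is replaced by the empty one, to make it finite everywhere.
  let V : Ω → Set E := fun ω => if ω ∈ G then ∅ else pointSet (η ω)
  have hgood' : ∀ ω, ω ∉ G → (pointSet (η ω)).Finite ∧ ∀ A, MeasurableSet A →
      η ω A = ((A ∩ pointSet (η ω)).encard : ℝ≥0∞) := by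
    intro ω hω
    by_contra hc
    exact hω (hGsub hc)
  have hV : ∀ ω, (V ω).Finite := by
    intro ω
    by_cases hω : ω ∈ G
    · simp [V, hω]
    · simpa [V, hω] using (hgood' ω hω).1
  have hVae : ∀ᵐ ω ∂P, V ω = pointSet (η ω) := by
    have : ∀ᵐ ω ∂P, ω ∉ G := by simpa [ae_iff] using hG0
    filter_upwards [this] with ω hω
    simp [V, hω]
  have hVη : ∀ᵐ ω ∂P, ∀ A, MeasurableSet A → ((A ∩ V ω).encard : ℝ≥0∞) = η ω A := by
    filter_upwards [hgood, hVae] with ω h1 h2 A hA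
    rw [h2, h1.2 A hA]
  have hVm : ∀ A, MeasurableSet A → Measurable fun ω => ((A ∩ V ω).encard : ℝ≥0∞) := by
    intro A hA
    have : (fun ω => ((A ∩ V ω).encard : ℝ≥0∞)) = Gᶜ.indicator fun ω => η ω A := by
      ext ω
      by_cases hω : ω ∈ G
      · simp [V, hω]
      · rw [indicator_of_mem (by simpa using hω), (hgood' ω hω).2 A hA]
        simp [V, hω]
    rw [this]
    exact (h.measurable_apply hA).indicator hGm.compl
  let κ : Ω → Measure (ι → E) := fun ω => Measure.count.restrict (univ.pi fun _ => V ω)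
  have hκ : Measurable κ := measurable_count_restrict_pi hV hVm
  let I : Set (ι → E) := {q | Function.Injective q}
  have hI : MeasurableSet I := measurableSet_injective
  have hfin : ∀ ω, (univ.pi fun _ : ι => V ω).Finite := fun ω => Set.Finite.pi fun _ => hV ω
  have hκB : ∀ B : Set (ι → E), MeasurableSet B → ∀ ω,
      κ ω (B ∩ I) = ((distinctTuples (V ω) B).encard : ℝ≥0∞) := by
    intro B hB ω
    simp only [κ]
    rw [Measure.restrict_apply (hB.inter hI), Measure.count_apply
      ((hB.inter hI).inter (hfin ω).measurableSet)]
    congr 2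
    ext q
    simp only [distinctTuples, I, mem_inter_iff, mem_ofPred_eq, Set.mem_pi, mem_univ, true_imp_iff,
      and_assoc]
  have hae : (fun ω => ((distinctTuples (pointSet (η ω)) B).encard : ℝ≥0∞)) =ᵐ[P]
      fun ω => κ ω (B ∩ I) := by
    filter_upwards [hVae] with ω hω
    rw [hκB B hB, hω]
  refine ⟨⟨_, (Measure.measurable_coe (hB.inter hI)).comp hκ, hae⟩, ?_⟩
  rw [lintegral_congr_ae hae]
  have hbox : ∀ s : ι → Set E, (∀ i, MeasurableSet (s i)) →
      (Pairwise fun i j => Disjoint (s i) (s j)) →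
      P.bind κ (univ.pi s) = ∏ i, μ (s i) := by
    intro s hs hd
    rw [Measure.bind_apply (MeasurableSet.univ_pi hs) hκ.aemeasurable,
      ← h.lintegral_prod_apply hs hd]
    refine lintegral_congr_ae ?_
    filter_upwards [hVη] with ω hω
    simp only [κ]
    rw [Measure.restrict_apply (MeasurableSet.univ_pi hs), ← pi_inter_distrib,
      Measure.count_apply, toENNReal_encard_univ_pi]
    · exact Finset.prod_congr rfl fun i _ => hω _ (hs i)
    · exact ((hfin ω).subset (pi_mono fun i _ => inter_subset_right)).measurableSet
  have hrestr : (P.bind κ).restrict I = (Measure.pi fun _ : ι => μ).restrict I := by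
    obtain ⟨K, _, s, hs, hd, hcov⟩ := exists_countable_disjoint_boxes ι E
    simp only [I, hcov]
    rw [Measure.restrict_iUnion_congr]
    intro k
    rw [Measure.restrict_pi_pi]
    refine (Measure.pi_eq fun t ht => ?_).symm
    rw [Measure.restrict_apply (MeasurableSet.univ_pi ht), ← pi_inter_distrib,
      hbox _ (fun i => (ht i).inter (hs k i))
        fun i j hij => (hd k hij).mono inter_subset_right inter_subset_right]
    exact Finset.prod_congr rfl fun i _ => (Measure.restrict_apply (ht i)).symm
  rw [← Measure.bind_apply (hB.inter hI) hκ.aemeasurable, ← Measure.restrict_apply hB, hrestr,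
    Measure.restrict_apply hB]
  exact measure_inter_conull (by simpa [I, ae_iff, compl_ofPred] using ae_injective_pi (ι := ι) μ)

end FactorialMoment

/-! ### Overlapping crossings span sparse trees -/

section CrossingSet

variable {d : ℕ}

/-- The quadruples of (not necessarily distinct) points of space which form two edges of length at
most `δ` whose projections to `L` meet. -/
def crossingSet (L : Submodule ℝ (EuclideanSpace ℝ (Fin d))) (δ : ℝ) :
    Set (Fin 4 → EuclideanSpace ℝ (Fin d)) :=
  {q | ‖q 0 - q 1‖ ≤ δ ∧ ‖q 2 - q 3‖ ≤ δ ∧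
    (projSegment L (q 0) (q 1) ∩ projSegment L (q 2) (q 3)).Nonempty}

variable {L : Submodule ℝ (EuclideanSpace ℝ (Fin d))} {δ : ℝ}

theorem crossingQuadruples_eq (V : Set (EuclideanSpace ℝ (Fin d))) :
    crossingQuadruples L δ V = distinctTuples V (crossingSet L δ) := by
  ext q
  simp only [crossingQuadruples, distinctTuples, crossingSet, mem_ofPred_eq]
  tauto

theorem isClosed_crossingSet : IsClosed (crossingSet L δ) := by
  have h1 : IsClosed {q : Fin 4 → EuclideanSpace ℝ (Fin d) | ‖q 0 - q 1‖ ≤ δ} :=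
    isClosed_le (by fun_prop) continuous_const
  have h2 : IsClosed {q : Fin 4 → EuclideanSpace ℝ (Fin d) | ‖q 2 - q 3‖ ≤ δ} :=
    isClosed_le (by fun_prop) continuous_const
  -- The crossing condition is the projection of a closed set along a compact square.
  let F : Set ((Fin 4 → EuclideanSpace ℝ (Fin d)) × (Icc (0 : ℝ) 1 × Icc (0 : ℝ) 1)) :=
    {z | L.orthogonalProjectionOnto (AffineMap.lineMap (z.1 0) (z.1 1) (z.2.1 : ℝ)) =
      L.orthogonalProjectionOnto (AffineMap.lineMap (z.1 2) (z.1 3) (z.2.2 : ℝ))}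
  have hF : IsClosed F := by
    refine isClosed_eq ?_ ?_ <;> simp only [AffineMap.lineMap_apply_module] <;> fun_prop
  have h3 : IsClosed {q : Fin 4 → EuclideanSpace ℝ (Fin d) |
      (projSegment L (q 0) (q 1) ∩ projSegment L (q 2) (q 3)).Nonempty} := by
    have := isClosedMap_fst_of_compactSpace (X := Fin 4 → EuclideanSpace ℝ (Fin d))
      (Y := Icc (0 : ℝ) 1 × Icc (0 : ℝ) 1) F hF
    convert! this using 1
    ext q
    simp only [projSegment, segment_eq_image_lineMap, mem_ofPred_eq]
    constructor
    · rintro ⟨x, ⟨_, ⟨a, ha, rfl⟩, rfl⟩, ⟨_, ⟨b, hb, rfl⟩, h⟩⟩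
      exact ⟨(q, (⟨a, ha⟩, ⟨b, hb⟩)), h.symm, rfl⟩
    · rintro ⟨⟨q', a, b⟩, h, rfl⟩
      exact ⟨_, ⟨_, ⟨a, a.2, rfl⟩, rfl⟩, ⟨_, ⟨b, b.2, rfl⟩, h.symm⟩⟩
  exact h1.inter (h2.inter h3)

/-- The permutations of the four indices that preserve the pairing `{{0, 1}, {2, 3}}`, as the
centralizer of the involution `![1, 0, 3, 2]` swapping partners. -/
def pairingPerms : Finset (Equiv.Perm (Fin 4)) :=
  Finset.univ.filter fun σ => ∀ i, σ (![1, 0, 3, 2] i) = ![1, 0, 3, 2] (σ i)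

theorem card_pairingPerms : pairingPerms.card = 8 := by decide

theorem projSegment_symm (v w : EuclideanSpace ℝ (Fin d)) :
    projSegment L v w = projSegment L w v := by
  rw [projSegment, projSegment, segment_symm]

theorem comp_mem_crossingSet {q : Fin 4 → EuclideanSpace ℝ (Fin d)} (hq : q ∈ crossingSet L δ)
    {σ : Equiv.Perm (Fin 4)} (hσ : σ ∈ pairingPerms) : q ∘ σ ∈ crossingSet L δ := by
  have key : ∀ σ ∈ pairingPerms,
      (σ 0, σ 1, σ 2, σ 3) ∈ ({(0, 1, 2, 3), (0, 1, 3, 2), (1, 0, 2, 3), (1, 0, 3, 2), (2, 3, 0, 1),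
        (2, 3, 1, 0), (3, 2, 0, 1), (3, 2, 1, 0)} : Finset (Fin 4 × Fin 4 × Fin 4 × Fin 4)) := by
    decide
  obtain ⟨h1, h2, h3⟩ := hq
  have h1' := h1
  have h2' := h2
  rw [norm_sub_rev] at h1' h2'
  have h := key σ hσ
  simp only [Finset.mem_insert, Finset.mem_singleton, Prod.mk.injEq] at h
  rcases h with ⟨a, b, c, e⟩ | ⟨a, b, c, e⟩ | ⟨a, b, c, e⟩ | ⟨a, b, c, e⟩ | ⟨a, b, c, e⟩ |
    ⟨a, b, c, e⟩ | ⟨a, b, c, e⟩ | ⟨a, b, c, e⟩ <;>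
  simp only [crossingSet, mem_ofPred_eq, Function.comp_apply, a, b, c, e]
  · exact ⟨h1, h2, h3⟩
  · exact ⟨h1, h2', by rwa [projSegment_symm (q 3)]⟩
  · exact ⟨h1', h2, by rwa [projSegment_symm (q 1)]⟩
  · exact ⟨h1', h2', by rwa [projSegment_symm (q 3), projSegment_symm (q 1)]⟩
  · exact ⟨h2, h1, by rwa [inter_comm]⟩
  · exact ⟨h2, h1', by rwa [projSegment_symm (q 1), inter_comm]⟩
  · exact ⟨h2', h1, by rwa [projSegment_symm (q 3), inter_comm]⟩
  · exact ⟨h2', h1', by rwa [projSegment_symm (q 3), projSegment_symm (q 1), inter_comm]⟩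

theorem dist_orthogonalProjectionOnto_le (x y : EuclideanSpace ℝ (Fin d)) :
    dist (L.orthogonalProjectionOnto x) (L.orthogonalProjectionOnto y) ≤ dist x y := by
  rw [dist_eq_norm, dist_eq_norm, ← map_sub]
  exact L.norm_orthogonalProjectionOnto_apply_le _

theorem dist_le_of_mem_projSegment {v w : EuclideanSpace ℝ (Fin d)} {z : L}
    (hz : z ∈ projSegment L v w) :
    dist (L.orthogonalProjectionOnto v) z ≤ dist v w ∧
      dist (L.orthogonalProjectionOnto w) z ≤ dist v w := by
  obtain ⟨x, hx, rfl⟩ := hz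
  have h := dist_add_dist_of_mem_segment hx
  have h1 := dist_nonneg (x := v) (y := x)
  have h2 := dist_nonneg (x := x) (y := w)
  refine ⟨(dist_orthogonalProjectionOnto_le _ _).trans (by linarith),
    (dist_orthogonalProjectionOnto_le _ _).trans ?_⟩
  rw [dist_comm]
  linarith

theorem dist_proj_le_of_mem_crossingSet {q : Fin 4 → EuclideanSpace ℝ (Fin d)}
    (hq : q ∈ crossingSet L δ) (i j : Fin 4) :
    dist (L.orthogonalProjectionOnto (q i)) (L.orthogonalProjectionOnto (q j)) ≤ 2 * δ := by
  obtain ⟨h1, h2, z, hz1, hz2⟩ := hq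
  rw [← dist_eq_norm] at h1 h2
  have key : ∀ i, dist (L.orthogonalProjectionOnto (q i)) z ≤ δ := by
    have a1 := dist_le_of_mem_projSegment hz1
    have a2 := dist_le_of_mem_projSegment hz2
    intro i
    fin_cases i
    · exact a1.1.trans h1
    · exact a1.2.trans h1
    · exact a2.1.trans h2
    · exact a2.2.trans h2
  linarith [dist_triangle_right (L.orthogonalProjectionOnto (q i))
    (L.orthogonalProjectionOnto (q j)) z,
    key i, key j]

end CrossingSet

section Trees

variable {d : ℕ}

/-- The region to which a new point is confined by an old point `x`: a ball around `x`, or a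
cylinder around `x` orthogonal to `L`. -/
def treeNbhd (L : Submodule ℝ (EuclideanSpace ℝ (Fin d))) (δ : ℝ) (ball : Bool)
    (x : EuclideanSpace ℝ (Fin d)) : Set (EuclideanSpace ℝ (Fin d)) :=
  if ball then {y | dist y x ≤ 3 * δ}
  else {y | dist (L.orthogonalProjectionOnto y) (L.orthogonalProjectionOnto x) ≤ 4 * δ}

/-- The tuples in which each point but the first one is confined to the region, of the type
prescribed by `ball`, given by its parent. -/
def treeSet (L : Submodule ℝ (EuclideanSpace ℝ (Fin d))) (δ : ℝ) {n : ℕ}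
    (par : Fin n → Fin (n + 1)) (ball : Fin n → Bool) :
    Set (Fin (n + 1) → EuclideanSpace ℝ (Fin d)) :=
  {r | ∀ i, r i.succ ∈ treeNbhd L δ (ball i) (r (par i))}

/-- Parents precede their children, and the number of vertices and the number of cylinders are
such that the expected number of trees in the Poisson process is `O(δ)`. -/
def IsSparseTree {n : ℕ} (par : Fin n → Fin (n + 1)) (ball : Fin n → Bool) : Prop :=
  (∀ i, par i ≤ i.castSucc) ∧ (n, (Finset.univ.filter fun i => ball i = false).card) ∈
    ({(3, 0), (4, 1), (5, 2), (5, 1), (6, 2)} : Finset (ℕ × ℕ))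

/-- A tree with at most six edges, given by parents and edge types, and the positions in it of the
points of two quadruples. -/
abbrev TreeCode : Type :=
  Σ n : Fin 7,
    (Fin n → Fin (n + 1)) × (Fin n → Bool) × (Fin 4 → Fin (n + 1)) × (Fin 4 → Fin (n + 1))

/-- The codes of sparse trees. -/
noncomputable def sparseTrees : Finset TreeCode :=
  (Set.toFinite {c : TreeCode | IsSparseTree c.2.1 c.2.2.1}).toFinset

theorem mem_sparseTrees {c : TreeCode} : c ∈ sparseTrees ↔ IsSparseTree c.2.1 c.2.2.1 := by
  rw [sparseTrees, Set.Finite.mem_toFinset, mem_ofPred_eq]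

/-- The pairs of quadruples of points of `V` read off from trees of the given kind. -/
def treePairs (L : Submodule ℝ (EuclideanSpace ℝ (Fin d))) (δ : ℝ)
    (V : Set (EuclideanSpace ℝ (Fin d))) (c : TreeCode) :
    Set ((Fin 4 → EuclideanSpace ℝ (Fin d)) × (Fin 4 → EuclideanSpace ℝ (Fin d))) :=
  (fun r => (r ∘ c.2.2.2.1, r ∘ c.2.2.2.2)) '' distinctTuples V (treeSet L δ c.2.1 c.2.2.1)

variable {L : Submodule ℝ (EuclideanSpace ℝ (Fin d))} {δ : ℝ}
  {V : Set (EuclideanSpace ℝ (Fin d))} {p q : Fin 4 → EuclideanSpace ℝ (Fin d)}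

/-- The finite set `S` of points of `V` is the vertex set of a tree with `n` edges, `c` of which
are of cylinder type. -/
def IsSpannedByTree (L : Submodule ℝ (EuclideanSpace ℝ (Fin d))) (δ : ℝ)
    (V : Set (EuclideanSpace ℝ (Fin d))) (n c : ℕ) (S : Set (EuclideanSpace ℝ (Fin d))) : Prop :=
  ∃ (par : Fin n → Fin (n + 1)) (ball : Fin n → Bool), (∀ i, par i ≤ i.castSucc) ∧
    (Finset.univ.filter fun i => ball i = false).card = c ∧
    ∃ r ∈ distinctTuples V (treeSet L δ par ball), range r = S

theorem isSpannedByTree_singleton {x : EuclideanSpace ℝ (Fin d)} (hx : x ∈ V) :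
    IsSpannedByTree L δ V 0 0 {x} := by
  refine ⟨Fin.elim0, Fin.elim0, fun i => i.elim0, rfl, fun _ => x,
    ⟨fun i => i.elim0, fun i j _ => by lia, fun _ => hx⟩, ?_⟩
  simp

theorem IsSpannedByTree.insert {n c : ℕ} {S : Set (EuclideanSpace ℝ (Fin d))}
    (h : IsSpannedByTree L δ V n c S) {b : Bool} {x y : EuclideanSpace ℝ (Fin d)}
    (hxS : x ∉ S) (hxV : x ∈ V) (hy : y ∈ S) (hxy : x ∈ treeNbhd L δ b y) :
    IsSpannedByTree L δ V (n + 1) (c + if b then 0 else 1) (insert x S) := by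
  obtain ⟨par, ball, hpar, hc, r, ⟨hr, hinj, hV⟩, rfl⟩ := h
  obtain ⟨j, rfl⟩ := hy
  have hr' : ∀ j, Fin.snoc (α := fun _ => EuclideanSpace ℝ (Fin d)) r x j.castSucc = r j := by
    simp
  have hlast : Fin.snoc (α := fun _ => EuclideanSpace ℝ (Fin d)) r x (Fin.last _) = x := by simp
  refine ⟨Fin.snoc (fun i => (par i).castSucc) j.castSucc, Fin.snoc ball b, ?_, ?_,
    Fin.snoc r x, ⟨?_, Fin.snoc_injective_of_injective hinj hxS, ?_⟩, ?_⟩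
  · refine Fin.lastCases ?_ fun i => ?_
    · rw [Fin.snoc_last]
      exact Fin.castSucc_le_castSucc_iff.2 (Fin.le_last j)
    · rw [Fin.snoc_castSucc]
      exact Fin.castSucc_le_castSucc_iff.2 (hpar i)
  · rw [Finset.card_filter, Fin.sum_univ_castSucc, ← hc, Finset.card_filter]
    cases b <;> simp
  · refine Fin.lastCases ?_ fun i => ?_
    · rw [Fin.snoc_last, Fin.snoc_last, Fin.succ_last, hlast, hr']
      exact hxy
    · rw [Fin.snoc_castSucc, Fin.snoc_castSucc, Fin.succ_castSucc, hr', hr']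
      exact hr i
  · refine Fin.lastCases (by rwa [hlast]) fun i => ?_
    rw [hr']
    exact hV i
  · exact Fin.range_snoc _ _

theorem IsSpannedByTree.exists_mem_treePairs {n c : ℕ} {S : Set (EuclideanSpace ℝ (Fin d))}
    (h : IsSpannedByTree L δ V n c S)
    (hnc : (n, c) ∈ ({(3, 0), (4, 1), (5, 2), (5, 1), (6, 2)} : Finset (ℕ × ℕ)))
    (hp : ∀ i, p i ∈ S) (hq : ∀ i, q i ∈ S) :
    ∃ c ∈ sparseTrees, (p, q) ∈ treePairs L δ V c := by
  obtain ⟨par, ball, hpar, rfl, r, hr, rfl⟩ := h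
  choose a ha using hp
  choose b hb using hq
  have hn : n < 7 := by
    simp only [Finset.mem_insert, Finset.mem_singleton, Prod.mk.injEq] at hnc
    lia
  exact ⟨⟨⟨n, hn⟩, par, ball, a, b⟩, mem_sparseTrees.2 ⟨hpar, hnc⟩, r, hr,
    Prod.ext (funext ha) (funext hb)⟩

theorem mem_treeNbhd_true {x y : EuclideanSpace ℝ (Fin d)} (hδ : 0 ≤ δ) (h : dist x y ≤ δ) :
    x ∈ treeNbhd L δ true y := by
  simp only [treeNbhd, if_true, mem_ofPred_eq]
  linarith

theorem range_fin_four (p : Fin 4 → EuclideanSpace ℝ (Fin d)) :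
    range p = insert (p 3) (insert (p 2) (insert (p 1) {p 0})) := by
  ext x
  simp only [mem_range, Fin.exists_fin_succ, mem_insert_iff, mem_singleton_iff]
  simp
  tauto

/-- A crossing is spanned by its two edges and a cylinder joining them. -/
theorem isSpannedByTree_crossing (hδ : 0 ≤ δ) (hp : p ∈ distinctTuples V (crossingSet L δ)) :
    IsSpannedByTree L δ V 3 1 (range p) := by
  obtain ⟨hK, hinj, hV⟩ := hp
  have h1 := hK.1
  have h2 := hK.2.1
  have h3 := dist_proj_le_of_mem_crossingSet hK 2 0
  rw [← dist_eq_norm, dist_comm] at h1 h2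
  have n : ∀ {i j : Fin 4}, i ≠ j → p i ≠ p j := fun h => hinj.ne h
  rw [range_fin_four]
  refine ((isSpannedByTree_singleton (hV 0)).insert (b := true) (x := p 1) (y := p 0) ?_ (hV 1) ?_
    (mem_treeNbhd_true hδ h1) |>.insert (b := false) (x := p 2) (y := p 0) ?_ (hV 2) ?_ ?_).insert
    (b := true) (x := p 3) (y := p 2) ?_ (hV 3) ?_ (mem_treeNbhd_true hδ h2)
  · simpa using n (by decide)
  · simp
  · simp [hinj.eq_iff]
  · simp
  · simp only [treeNbhd, mem_ofPred_eq, Bool.false_eq_true, if_false]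
    linarith
  · simp [hinj.eq_iff]
  · simp

theorem isSpannedByTree_of_close (hp : p ∈ distinctTuples V (crossingSet L δ))
    (hclose : ∀ i, dist (p i) (p 0) ≤ 3 * δ) :
    IsSpannedByTree L δ V 3 0 (range p) := by
  refine ⟨![0, 0, 0], ![true, true, true], by decide, by decide, p, ⟨?_, hp.2⟩, rfl⟩
  intro i
  fin_cases i <;> exact hclose _

/-- Two crossings on the same four points that pair them differently force all four points to be
close to each other. -/
theorem dist_le_of_comp_mem (hδ : 0 ≤ δ) (hp : p ∈ crossingSet L δ) {σ : Equiv.Perm (Fin 4)}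
    (hσ : σ ∉ pairingPerms) (hq : p ∘ σ ∈ crossingSet L δ) (i : Fin 4) :
    dist (p i) (p 0) ≤ 3 * δ := by
  have key : ∀ σ : Equiv.Perm (Fin 4), σ ∉ pairingPerms →
      ∃ s ∈ ({(σ 0, σ 1), (σ 1, σ 0), (σ 2, σ 3), (σ 3, σ 2)} : Finset (Fin 4 × Fin 4)),
        s.1 < 2 ∧ 2 ≤ s.2 := by
    decide
  obtain ⟨⟨a, b⟩, hab, ha, hb⟩ := key σ hσ
  have h1 : dist (p 1) (p 0) ≤ δ := by rw [dist_comm, dist_eq_norm]; exact hp.1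
  have h2 : dist (p 2) (p 3) ≤ δ := by rw [dist_eq_norm]; exact hp.2.1
  have hq1 : dist (p (σ 0)) (p (σ 1)) ≤ δ := by rw [dist_eq_norm]; exact hq.1
  have hq2 : dist (p (σ 2)) (p (σ 3)) ≤ δ := by rw [dist_eq_norm]; exact hq.2.1
  have h3 : dist (p b) (p a) ≤ δ := by
    simp only [Finset.mem_insert, Finset.mem_singleton, Prod.mk.injEq] at hab
    rcases hab with ⟨rfl, rfl⟩ | ⟨rfl, rfl⟩ | ⟨rfl, rfl⟩ | ⟨rfl, rfl⟩
    · rwa [dist_comm]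
    · exact hq1
    · rwa [dist_comm]
    · exact hq2
  have ha' : dist (p a) (p 0) ≤ δ := by
    have : a = 0 ∨ a = 1 := (by decide : ∀ a : Fin 4, a < 2 → a = 0 ∨ a = 1) a ha
    rcases this with rfl | rfl
    · simpa using hδ
    · exact h1
  have hi : i = 0 ∨ i = 1 ∨ dist (p i) (p b) ≤ δ := by
    have : ∀ i b : Fin 4, 2 ≤ b → i = 0 ∨ i = 1 ∨ i = b ∨ (i = 2 ∧ b = 3) ∨ (i = 3 ∧ b = 2) := by
      decide
    rcases this i b hb with h | h | rfl | ⟨rfl, rfl⟩ | ⟨rfl, rfl⟩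
    · exact Or.inl h
    · exact Or.inr (Or.inl h)
    · simp [hδ]
    · exact Or.inr (Or.inr h2)
    · exact Or.inr (Or.inr (by rwa [dist_comm]))
  rcases hi with rfl | rfl | hi
  · simpa using by linarith
  · linarith
  · linarith [dist_triangle (p i) (p b) (p 0), dist_triangle (p b) (p a) (p 0)]

/-- Two overlapping crossings which are not the same crossing up to the order of its points arise
from a sparse tree. -/
theorem exists_mem_treePairs_of_overlap (hδ : 0 ≤ δ)
    (hp : p ∈ distinctTuples V (crossingSet L δ)) (hq : q ∈ distinctTuples V (crossingSet L δ))
    (hover : ¬ Disjoint (range p) (range q)) (hsymm : ¬ ∃ σ ∈ pairingPerms, q = p ∘ σ) :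
    ∃ c ∈ sparseTrees, (p, q) ∈ treePairs L δ V c := by
  have hT := isSpannedByTree_crossing hδ hp
  have pp : ∀ i, p i ∈ range p := fun i => mem_range_self i
  have e01 : dist (q 0) (q 1) ≤ δ := by rw [dist_eq_norm]; exact hq.1.1
  have e23 : dist (q 2) (q 3) ≤ δ := by rw [dist_eq_norm]; exact hq.1.2.1
  have e10 : dist (q 1) (q 0) ≤ δ := by rwa [dist_comm]
  have e32 : dist (q 3) (q 2) ≤ δ := by rwa [dist_comm]
  have hV := hq.2.2
  have hne : ∀ {i j : Fin 4}, i ≠ j → q i ≠ q j := fun h => hq.2.1.ne h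
  -- All points of `q` are in the cylinder around `p 0` as soon as one of them is an old point.
  have hcyl : ∀ {k : Fin 4}, q k ∈ range p → ∀ j, q j ∈ treeNbhd L δ false (p 0) := by
    rintro k ⟨i, hi⟩ j
    simp only [treeNbhd, mem_ofPred_eq, Bool.false_eq_true, if_false]
    have h1 := dist_proj_le_of_mem_crossingSet hq.1 j k
    have h2 := dist_proj_le_of_mem_crossingSet hp.1 i 0
    rw [hi] at h2
    linarith [dist_triangle (L.orthogonalProjectionOnto (q j)) (L.orthogonalProjectionOnto (q k))
      (L.orthogonalProjectionOnto (p 0))]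
  -- One new point, joined to its old partner.
  have one : ∀ {j k : Fin 4}, q j ∉ range p → q k ∈ range p → dist (q j) (q k) ≤ δ →
      (∀ l, l ≠ j → q l ∈ range p) →
      ∃ c ∈ sparseTrees, (p, q) ∈ treePairs L δ V c := by
    intro j k hj hk hjk hold
    refine (hT.insert hj (hV j) hk (mem_treeNbhd_true hδ hjk)).exists_mem_treePairs (by decide)
      (fun i => mem_insert_of_mem _ (pp i)) fun l => ?_
    by_cases hl : l = j
    · simp [hl]
    · exact mem_insert_of_mem _ (hold l hl)
  -- Two new points, each joined to its old partner.
  have two : ∀ {j k j' k' : Fin 4}, j ≠ j' → q j ∉ range p → q k ∈ range p → dist (q j) (q k) ≤ δ →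
      q j' ∉ range p → q k' ∈ range p → dist (q j') (q k') ≤ δ →
      (∀ l, l ≠ j → l ≠ j' → q l ∈ range p) →
      ∃ c ∈ sparseTrees, (p, q) ∈ treePairs L δ V c := by
    intro j k j' k' hjj hj hk hjk hj' hk' hjk' hold
    refine ((hT.insert hj (hV j) hk (mem_treeNbhd_true hδ hjk)).insert (x := q j') ?_ (hV j')
      (mem_insert_of_mem _ hk') (mem_treeNbhd_true hδ hjk')).exists_mem_treePairs (by decide)
      (fun i => mem_insert_of_mem _ (mem_insert_of_mem _ (pp i))) fun l => ?_
    · simp only [mem_insert_iff, not_or]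
      exact ⟨hne hjj.symm, hj'⟩
    · by_cases hl : l = j
      · simp [hl]
      by_cases hl' : l = j'
      · simp [hl']
      exact mem_insert_of_mem _ (mem_insert_of_mem _ (hold l hl hl'))
  -- Two new points forming an edge, joined to the old ones by a cylinder.
  have edge : ∀ {j j' k : Fin 4}, j ≠ j' → q j ∉ range p → q j' ∉ range p → dist (q j') (q j) ≤ δ →
      q k ∈ range p → (∀ l, l ≠ j → l ≠ j' → q l ∈ range p) →
      ∃ c ∈ sparseTrees, (p, q) ∈ treePairs L δ V c := by
    intro j j' k hjj hj hj' hjj' hk hold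
    refine ((hT.insert hj (hV j) (pp 0) (hcyl hk j)).insert (x := q j') ?_ (hV j')
      (mem_insert _ _) (mem_treeNbhd_true hδ hjj')).exists_mem_treePairs (by decide)
      (fun i => mem_insert_of_mem _ (mem_insert_of_mem _ (pp i))) fun l => ?_
    · simp only [mem_insert_iff, not_or]
      exact ⟨hne hjj.symm, hj'⟩
    · by_cases hl : l = j
      · simp [hl]
      by_cases hl' : l = j'
      · simp [hl']
      exact mem_insert_of_mem _ (mem_insert_of_mem _ (hold l hl hl'))
  -- Three new points: the partner of the old one, and an edge joined by a cylinder.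
  have three : ∀ {i k j j' : Fin 4}, i ≠ j → i ≠ j' → j ≠ j' → q i ∉ range p → q k ∈ range p →
      dist (q i) (q k) ≤ δ → q j ∉ range p → q j' ∉ range p → dist (q j') (q j) ≤ δ →
      (∀ l, l ≠ i → l ≠ j → l ≠ j' → q l ∈ range p) →
      ∃ c ∈ sparseTrees, (p, q) ∈ treePairs L δ V c := by
    intro i k j j' hij hij' hjj hi hk hik hj hj' hjj' hold
    refine (((hT.insert hi (hV i) hk (mem_treeNbhd_true hδ hik)).insert (x := q j) ?_ (hV j)
      (mem_insert_of_mem _ (pp 0)) (hcyl hk j)).insert (x := q j') ?_ (hV j') (mem_insert _ _)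
      (mem_treeNbhd_true hδ hjj')).exists_mem_treePairs (by decide)
      (fun i => mem_insert_of_mem _ (mem_insert_of_mem _ (mem_insert_of_mem _ (pp i))))
      fun l => ?_
    · simp only [mem_insert_iff, not_or]
      exact ⟨hne hij.symm, hj⟩
    · simp only [mem_insert_iff, not_or]
      exact ⟨hne hjj.symm, hne hij'.symm, hj'⟩
    · by_cases hl : l = i
      · simp [hl]
      by_cases hl' : l = j
      · simp [hl']
      by_cases hl'' : l = j'
      · simp [hl'']
      exact mem_insert_of_mem _ (mem_insert_of_mem _ (mem_insert_of_mem _ (hold l hl hl' hl'')))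
  by_cases h0 : q 0 ∈ range p <;> by_cases h1 : q 1 ∈ range p <;>
    by_cases h2 : q 2 ∈ range p <;> by_cases h3 : q 3 ∈ range p
  · have hold : ∀ l, q l ∈ range p := by
      intro l; fin_cases l <;> assumption
    choose s hs using hold
    have hsinj : Function.Injective s := fun i j hij => hq.2.1 (by rw [← hs i, ← hs j, hij])
    let σ : Equiv.Perm (Fin 4) := Equiv.ofBijective s (Finite.injective_iff_bijective.1 hsinj)
    have hqσ : q = p ∘ σ := funext fun i => (hs i).symm
    have hσ : σ ∉ pairingPerms := fun h => hsymm ⟨σ, h, hqσ⟩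
    refine (isSpannedByTree_of_close hp (dist_le_of_comp_mem hδ hp.1 hσ
      (hqσ ▸ hq.1))).exists_mem_treePairs (by decide) pp fun l => ⟨s l, hs l⟩
  · exact one h3 h2 e32 (by simp [Fin.forall_fin_succ, -mem_range, *])
  · exact one h2 h3 e23 (by simp [Fin.forall_fin_succ, -mem_range, *])
  · exact edge (by decide) h2 h3 e32 h0 (by simp [Fin.forall_fin_succ, -mem_range, *])
  · exact one h1 h0 e10 (by simp [Fin.forall_fin_succ, -mem_range, *])
  · exact two (by decide) h1 h0 e10 h3 h2 e32 (by simp [Fin.forall_fin_succ, -mem_range, *])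
  · exact two (by decide) h1 h0 e10 h2 h3 e23 (by simp [Fin.forall_fin_succ, -mem_range, *])
  · exact three (by decide) (by decide) (by decide) h1 h0 e10 h2 h3 e32
      (by simp [Fin.forall_fin_succ, -mem_range, *])
  · exact one h0 h1 e01 (by simp [Fin.forall_fin_succ, -mem_range, *])
  · exact two (by decide) h0 h1 e01 h3 h2 e32 (by simp [Fin.forall_fin_succ, -mem_range, *])
  · exact two (by decide) h0 h1 e01 h2 h3 e23 (by simp [Fin.forall_fin_succ, -mem_range, *])
  · exact three (by decide) (by decide) (by decide) h0 h1 e01 h2 h3 e32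
      (by simp [Fin.forall_fin_succ, -mem_range, *])
  · exact edge (by decide) h0 h1 e10 h2 (by simp [Fin.forall_fin_succ, -mem_range, *])
  · exact three (by decide) (by decide) (by decide) h3 h2 e32 h0 h1 e10
      (by simp [Fin.forall_fin_succ, -mem_range, *])
  · exact three (by decide) (by decide) (by decide) h2 h3 e23 h0 h1 e10
      (by simp [Fin.forall_fin_succ, -mem_range, *])
  · refine (hover ?_).elim
    rw [disjoint_comm, disjoint_left]
    rintro _ ⟨l, rfl⟩
    fin_cases l <;> assumption

end Trees

/-! ### Counting pairs of crossings, and the measure of trees -/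

section PairCount

variable {d : ℕ}

/-- The pairs of overlapping crossings that are not the same crossing up to the order of its
points. -/
def overlappingPairs (L : Submodule ℝ (EuclideanSpace ℝ (Fin d))) (δ : ℝ)
    (V : Set (EuclideanSpace ℝ (Fin d))) :
    Set ((Fin 4 → EuclideanSpace ℝ (Fin d)) × (Fin 4 → EuclideanSpace ℝ (Fin d))) :=
  {z | z.1 ∈ distinctTuples V (crossingSet L δ) ∧ z.2 ∈ distinctTuples V (crossingSet L δ) ∧
    ¬ Disjoint (range z.1) (range z.2) ∧ ¬ ∃ σ ∈ pairingPerms, z.2 = z.1 ∘ σ}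

/-- The octuples consisting of two crossing quadruples. -/
def doubleCrossingSet (L : Submodule ℝ (EuclideanSpace ℝ (Fin d))) (δ : ℝ) :
    Set (Fin 4 ⊕ Fin 4 → EuclideanSpace ℝ (Fin d)) :=
  {r | r ∘ Sum.inl ∈ crossingSet L δ ∧ r ∘ Sum.inr ∈ crossingSet L δ}

variable (L : Submodule ℝ (EuclideanSpace ℝ (Fin d))) (δ : ℝ) (V : Set (EuclideanSpace ℝ (Fin d)))

/-- A pair of crossings is disjoint, or consists of two orderings of the same crossing (`8` for
each crossing quadruple), or overlaps in another way. -/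
theorem encard_sq_distinctTuples_crossingSet :
    (distinctTuples V (crossingSet L δ)).encard ^ 2 =
      (distinctTuples V (doubleCrossingSet L δ)).encard +
        8 * (distinctTuples V (crossingSet L δ)).encard + (overlappingPairs L δ V).encard := by
  set T := distinctTuples V (crossingSet L δ) with hT
  let f : (Fin 4 ⊕ Fin 4 → EuclideanSpace ℝ (Fin d)) →
      (Fin 4 → EuclideanSpace ℝ (Fin d)) × (Fin 4 → EuclideanSpace ℝ (Fin d)) :=
    fun r => (r ∘ Sum.inl, r ∘ Sum.inr)
  have hf : Function.Injective f := by
    intro r s h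
    funext i
    rcases i with i | i
    · exact congrFun (congrArg Prod.fst h) i
    · exact congrFun (congrArg Prod.snd h) i
  let g : (Fin 4 → EuclideanSpace ℝ (Fin d)) × Equiv.Perm (Fin 4) →
      (Fin 4 → EuclideanSpace ℝ (Fin d)) × (Fin 4 → EuclideanSpace ℝ (Fin d)) :=
    fun z => (z.1, z.1 ∘ z.2)
  have hg : InjOn g (T ×ˢ (pairingPerms : Set (Equiv.Perm (Fin 4)))) := by
    rintro ⟨p, σ⟩ ⟨hp, -⟩ ⟨p', σ'⟩ - h
    have h1 : p = p' := congrArg Prod.fst h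
    subst h1
    have h2 : p ∘ σ = p ∘ σ' := congrArg Prod.snd h
    have : σ = σ' := Equiv.ext fun i => hp.2.1 (congrFun h2 i)
    rw [this]
  have hcover : T ×ˢ T = f '' distinctTuples V (doubleCrossingSet L δ) ∪
      g '' (T ×ˢ (pairingPerms : Set (Equiv.Perm (Fin 4)))) ∪ overlappingPairs L δ V := by
    ext ⟨p, q⟩
    constructor
    · rintro ⟨hp, hq⟩
      by_cases hd : Disjoint (range p) (range q)
      · refine Or.inl (Or.inl ⟨Sum.elim p q, ⟨⟨hp.1, hq.1⟩, ?_, ?_⟩, rfl⟩)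
        · exact hp.2.1.sumElim hq.2.1 fun i j h =>
            disjoint_left.1 hd (mem_range_self i) ⟨j, h.symm⟩
        · rintro (i | i)
          · exact hp.2.2 i
          · exact hq.2.2 i
      by_cases hs : ∃ σ ∈ pairingPerms, q = p ∘ σ
      · obtain ⟨σ, hσ, rfl⟩ := hs
        exact Or.inl (Or.inr ⟨(p, σ), ⟨hp, hσ⟩, rfl⟩)
      · exact Or.inr ⟨hp, hq, hd, hs⟩
    · rintro ((⟨r, hr, h⟩ | ⟨⟨p', σ⟩, ⟨hp, hσ⟩, h⟩) | h)
      · rw [← h]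
        exact ⟨⟨hr.1.1, hr.2.1.comp Sum.inl_injective, fun i => hr.2.2 _⟩,
          ⟨hr.1.2, hr.2.1.comp Sum.inr_injective, fun i => hr.2.2 _⟩⟩
      · rw [← h]
        exact ⟨hp, comp_mem_crossingSet hp.1 hσ, hp.2.1.comp σ.injective, fun i => hp.2.2 _⟩
      · exact ⟨h.1, h.2.1⟩
  have hd1 : Disjoint (f '' distinctTuples V (doubleCrossingSet L δ))
      (g '' (T ×ˢ (pairingPerms : Set (Equiv.Perm (Fin 4))))) := by
    rw [disjoint_left]
    rintro _ ⟨r, hr, rfl⟩ ⟨⟨p, σ⟩, -, h⟩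
    have h1 : p = r ∘ Sum.inl := congrArg Prod.fst h
    have h2 : p ∘ σ = r ∘ Sum.inr := congrArg Prod.snd h
    have h3 : r (Sum.inl (σ 0)) = r (Sum.inr 0) := by
      rw [h1] at h2
      exact congrFun h2 0
    exact absurd (hr.2.1 h3) (by simp)
  have hd2 : Disjoint (f '' distinctTuples V (doubleCrossingSet L δ) ∪
      g '' (T ×ˢ (pairingPerms : Set (Equiv.Perm (Fin 4))))) (overlappingPairs L δ V) := by
    rw [disjoint_left]
    rintro _ (⟨r, hr, rfl⟩ | ⟨⟨p, σ⟩, ⟨-, hσ⟩, rfl⟩) h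
    · refine h.2.2.1 ?_
      rw [disjoint_left]
      rintro _ ⟨i, rfl⟩ ⟨j, hj⟩
      exact absurd (hr.2.1 hj) (by simp)
    · exact h.2.2.2 ⟨σ, hσ, rfl⟩
  rw [sq, ← encard_prod, hcover, encard_union_eq hd2, encard_union_eq hd1, hf.encard_image,
    hg.encard_image, encard_prod, encard_coe_eq_coe_finsetCard, card_pairingPerms, mul_comm]
  rfl

theorem encard_overlappingPairs_le {δ : ℝ} (hδ : 0 ≤ δ) :
    (overlappingPairs L δ V).encard ≤ ∑ c ∈ sparseTrees,
      (distinctTuples V (treeSet L δ c.2.1 c.2.2.1)).encard := by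
  have h : overlappingPairs L δ V ⊆
      ⋃ c ∈ sparseTrees, treePairs L δ V c := by
    rintro ⟨p, q⟩ ⟨hp, hq, h1, h2⟩
    obtain ⟨c, hc, hpq⟩ := exists_mem_treePairs_of_overlap hδ hp hq h1 h2
    exact mem_biUnion hc hpq
  refine (encard_le_encard h).trans ((Finset.set_encard_biUnion_le _ _).trans ?_)
  exact Finset.sum_le_sum fun c _ => encard_image_le _ _

end PairCount

section TreeMeasure

variable {d : ℕ} {L : Submodule ℝ (EuclideanSpace ℝ (Fin d))} {δ : ℝ}

theorem measurableSet_treeNbhd_comp {ι : Type*} [Fintype ι] (b : Bool) (i j : ι) :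
    MeasurableSet {r : ι → EuclideanSpace ℝ (Fin d) | r i ∈ treeNbhd L δ b (r j)} := by
  cases b
  · simp only [treeNbhd, mem_ofPred_eq, Bool.false_eq_true, if_false]
    exact (isClosed_le (by fun_prop) continuous_const).measurableSet
  · simp only [treeNbhd, mem_ofPred_eq, if_true]
    exact (isClosed_le (by fun_prop) continuous_const).measurableSet

theorem measurableSet_treeSet {n : ℕ} (par : Fin n → Fin (n + 1)) (ball : Fin n → Bool) :
    MeasurableSet (treeSet L δ par ball) := by
  have : treeSet L δ par ball = ⋂ i, {r | r i.succ ∈ treeNbhd L δ (ball i) (r (par i))} := by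
    ext r; simp [treeSet]
  rw [this]
  exact MeasurableSet.iInter fun i => measurableSet_treeNbhd_comp _ _ _

/-- Each vertex of a tree but the first one costs the measure of the region it is confined to. -/
theorem pi_treeSet_le (ν : Measure (EuclideanSpace ℝ (Fin d))) [IsProbabilityMeasure ν]
    {a : Bool → ℝ≥0∞} (ha : ∀ b x, ν (treeNbhd L δ b x) ≤ a b) {n : ℕ}
    {par : Fin n → Fin (n + 1)} (hpar : ∀ i, par i ≤ i.castSucc) (ball : Fin n → Bool) :
    (Measure.pi fun _ : Fin (n + 1) => ν) (treeSet L δ par ball) ≤ ∏ i, a (ball i) := by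
  let S : ℕ → Set (Fin (n + 1) → EuclideanSpace ℝ (Fin d)) := fun k =>
    {r | ∀ i : Fin n, i.val < k → r i.succ ∈ treeNbhd L δ (ball i) (r (par i))}
  have hSm : ∀ k, MeasurableSet (S k) := by
    intro k
    have : S k = ⋂ i : Fin n, ⋂ _ : i.val < k,
        {r | r i.succ ∈ treeNbhd L δ (ball i) (r (par i))} := by
      ext r; simp [S]
    rw [this]
    exact MeasurableSet.iInter fun i => MeasurableSet.iInter fun _ =>
      measurableSet_treeNbhd_comp _ _ _
  have key : ∀ k ≤ n, (Measure.pi fun _ : Fin (n + 1) => ν) (S k) ≤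
      ∏ i ∈ Finset.univ.filter (fun i : Fin n => i.val < k), a (ball i) := by
    intro k
    induction k with
    | zero =>
      intro _
      simpa using prob_le_one
    | succ k ih =>
      intro hk
      let j : Fin n := ⟨k, hk⟩
      have hfil : Finset.univ.filter (fun i : Fin n => i.val < k + 1) =
          insert j (Finset.univ.filter (fun i : Fin n => i.val < k)) := by
        ext i
        simp only [Finset.mem_filter, Finset.mem_univ, true_and, Finset.mem_insert, j, Fin.ext_iff]
        lia
      have hS : S (k + 1) = S k ∩ {r | r j.succ ∈ treeNbhd L δ (ball j) (r (par j))} := by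
        ext r
        simp only [S, mem_inter_iff, mem_ofPred_eq]
        constructor
        · exact fun h => ⟨fun i hi => h i (by lia), h j (by simp [j])⟩
        · rintro ⟨h1, h2⟩ i hi
          by_cases hik : i.val < k
          · exact h1 i hik
          · have : i = j := Fin.ext (by simp only [j]; lia)
            exact this ▸ h2
      have hne : ∀ i : Fin n, i.val ≤ k → par i ≠ j.succ := by
        intro i hi h
        have h1 := hpar i
        rw [h, Fin.le_def] at h1
        simp only [Fin.val_succ, Fin.val_castSucc, j] at h1
        lia
      rw [hfil, Finset.prod_insert (by simp [j]), hS]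
      refine le_trans ?_ (mul_le_mul_right (ih (by lia)) _)
      have := pi_inter_le_mul ν j.succ (hSm k)
        (measurableSet_treeNbhd_comp (L := L) (δ := δ) (ball j) j.succ (par j)) ?_
        (a := a (ball j)) ?_
      · simpa using this
      · intro r y
        refine forall_congr' fun i => imp_congr_right fun hi => ?_
        rw [Function.update_of_ne (hne i (by lia)), Function.update_of_ne]
        intro h
        have := Fin.succ_injective _ h
        simp [this, j] at hi
      · intro r
        simp only [mem_ofPred_eq, Function.update_self, Function.update_of_ne (hne j (by simp [j]))]
        exact ha _ _
  have h := key n le_rfl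
  have hS : S n = treeSet L δ par ball := by
    ext r; simp [S, treeSet]
  rw [hS, Finset.filter_true_of_mem (by simp)] at h
  exact h

end TreeMeasure

/-! ### The volume of balls and cylinders -/

section Volume

variable {d : ℕ} {L : Submodule ℝ (EuclideanSpace ℝ (Fin d))}

/-- A two-dimensional subspace is spanned by two vectors of some orthonormal basis of the space. -/
theorem exists_orthonormalBasis_mem (hL : Module.finrank ℝ L = 2) :
    ∃ (b : OrthonormalBasis (Fin d) ℝ (EuclideanSpace ℝ (Fin d))) (i j : Fin d), i ≠ j ∧
      b i ∈ L ∧ b j ∈ L := by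
  have hd : 2 ≤ d := by
    have := L.finrank_le
    rw [hL, finrank_euclideanSpace_fin] at this
    exact this
  let e : OrthonormalBasis (Fin 2) ℝ L := (stdOrthonormalBasis ℝ L).reindex (finCongr hL)
  let i : Fin d := ⟨0, by lia⟩
  let j : Fin d := ⟨1, by lia⟩
  have hij : i ≠ j := by simp [i, j]
  let v : Fin d → EuclideanSpace ℝ (Fin d) := fun k => if k = i then e 0 else e 1
  have hon : Orthonormal ℝ (fun k : Fin 2 => (e k : EuclideanSpace ℝ (Fin d))) :=
    e.orthonormal.comp_linearIsometry L.subtypeₗᵢ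
  have hv : Orthonormal ℝ (({i, j} : Set (Fin d)).domRestrict v) := by
    let g : ({i, j} : Set (Fin d)) → Fin 2 := fun k => if k.1 = i then 0 else 1
    have hg : Function.Injective g := by
      rintro ⟨k, hk⟩ ⟨l, hl⟩ h
      simp only [mem_insert_iff, mem_singleton_iff] at hk hl
      rcases hk with rfl | rfl <;> rcases hl with rfl | rfl <;> simp_all [g, hij.symm]
    have : ({i, j} : Set (Fin d)).domRestrict v =
        (fun k : Fin 2 => (e k : EuclideanSpace ℝ (Fin d))) ∘ g := by
      funext k
      by_cases hk : k.1 = i <;> simp [v, g, hk]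
    rw [this]
    exact hon.comp g hg
  obtain ⟨b, hb⟩ := hv.exists_orthonormalBasis_extension_of_card_eq (by simp)
  refine ⟨b, i, j, hij, ?_, ?_⟩
  · rw [hb i (by simp)]
    simp [v]
  · rw [hb j (by simp)]
    simp [v, hij.symm]

/-- In coordinates adapted to `L`, a cylinder of radius `ρ` around an affine subspace orthogonal
to `L` is contained, within a bounded set, in a box with two sides of length `2 ρ`. -/
theorem exists_volume_cylinder_le (hL : Module.finrank ℝ L = 2) {W : Set (EuclideanSpace ℝ (Fin d))}
    (hW : Bornology.IsBounded W) :
    ∃ C : ℝ, 0 ≤ C ∧ ∀ ρ, 0 ≤ ρ → ∀ x, volume.restrict W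
      {y | dist (L.orthogonalProjectionOnto y) (L.orthogonalProjectionOnto x) ≤ ρ} ≤
        ENNReal.ofReal (C * ρ ^ 2) := by
  obtain ⟨b, i, j, hij, hi, hj⟩ := exists_orthonormalBasis_mem hL
  obtain ⟨R, hR0, hR⟩ := hW.subset_closedBall_lt 0 0
  refine ⟨4 * (2 * R) ^ (Finset.univ \ {i, j} : Finset (Fin d)).card, by positivity,
    fun ρ hρ x => ?_⟩
  let s : Fin d → Set ℝ := fun k =>
    if k ∈ ({i, j} : Finset (Fin d)) then Icc (inner ℝ (b k) x - ρ) (inner ℝ (b k) x + ρ)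
    else Icc (-R) R
  have hmp := (PiLp.volume_preserving_ofLp (Fin d)).comp b.measurePreserving_repr
  have hcoord : ∀ k ∈ ({i, j} : Finset (Fin d)), ∀ y,
      dist (L.orthogonalProjectionOnto y) (L.orthogonalProjectionOnto x) ≤ ρ →
      |inner ℝ (b k) y - inner ℝ (b k) x| ≤ ρ := by
    intro k hk y hy
    have hkL : b k ∈ L := by
      simp only [Finset.mem_insert, Finset.mem_singleton] at hk
      rcases hk with rfl | rfl <;> assumption
    have h1 : inner ℝ (b k) (y - x) =
        inner ℝ (⟨b k, hkL⟩ : L) (L.orthogonalProjectionOnto (y - x)) := by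
      rw [Submodule.inner_orthogonalProjectionOnto_eq_of_mem_left]
    rw [← inner_sub_right, h1]
    refine (abs_real_inner_le_norm _ _).trans ?_
    rw [Submodule.coe_norm, b.orthonormal.1 k, one_mul, map_sub, ← dist_eq_norm]
    exact hy
  have hsub : {y | dist (L.orthogonalProjectionOnto y) (L.orthogonalProjectionOnto x) ≤ ρ} ∩ W ⊆
      (WithLp.ofLp ∘ b.repr) ⁻¹' univ.pi s := by
    rintro y ⟨hy, hyW⟩ k -
    simp only [Function.comp_apply, b.repr_apply_apply, s]
    split_ifs with hk
    · have := abs_le.1 (hcoord k hk y hy)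
      exact ⟨by linarith, by linarith⟩
    · rw [mem_Icc, ← abs_le]
      refine (abs_real_inner_le_norm _ _).trans ?_
      rw [b.orthonormal.1 k, one_mul]
      simpa using hR hyW
  have hs : MeasurableSet (univ.pi s) := by
    refine MeasurableSet.univ_pi fun k => ?_
    simp only [s]
    split_ifs <;> exact measurableSet_Icc
  have hclosed : MeasurableSet
      {y | dist (L.orthogonalProjectionOnto y) (L.orthogonalProjectionOnto x) ≤ ρ} :=
    (isClosed_le (by fun_prop) continuous_const).measurableSet
  rw [Measure.restrict_apply hclosed]
  refine (measure_mono hsub).trans ?_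
  rw [hmp.measure_preimage hs.nullMeasurableSet, volume_pi_pi,
    ← Finset.prod_sdiff (Finset.subset_univ {i, j}), Finset.prod_pair hij]
  have h1 : ∀ k ∈ (Finset.univ \ {i, j} : Finset (Fin d)), volume (s k) =
      ENNReal.ofReal (2 * R) := by
    intro k hk
    have : k ∉ ({i, j} : Finset (Fin d)) := (Finset.mem_sdiff.1 hk).2
    simp only [s, if_neg this, Real.volume_Icc]
    congr 1; ring
  have h2 : ∀ k ∈ ({i, j} : Finset (Fin d)), volume (s k) = ENNReal.ofReal (2 * ρ) := by
    intro k hk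
    simp only [s, if_pos hk, Real.volume_Icc]
    congr 1; ring
  rw [Finset.prod_congr rfl h1, h2 i (by simp), h2 j (by simp), Finset.prod_const,
    ← ENNReal.ofReal_pow (by positivity), ← ENNReal.ofReal_mul (by positivity),
    ← ENNReal.ofReal_mul (by positivity)]
  refine ENNReal.ofReal_le_ofReal (le_of_eq ?_)
  ring

/-- A common constant for both types of regions; the exponents are the codimensions of a point and
of the orthogonal complement of `L`. -/
theorem exists_volume_treeNbhd_le (hL : Module.finrank ℝ L = 2)
    {W : Set (EuclideanSpace ℝ (Fin d))} (hW : Bornology.IsBounded W) :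
    ∃ C : ℝ, 1 ≤ C ∧ ∀ δ, 0 ≤ δ → ∀ (b : Bool) x, volume.restrict W (treeNbhd L δ b x) ≤
        ENNReal.ofReal (C * δ ^ (if b then d else 2)) := by
  obtain ⟨C, hC, h⟩ := exists_volume_cylinder_le hL hW
  let v := (volume (Metric.ball (0 : EuclideanSpace ℝ (Fin d)) 1)).toReal
  have hv : 0 ≤ v := ENNReal.toReal_nonneg
  have h1 : 0 ≤ C * 4 ^ 2 := by positivity
  have h2 : 0 ≤ 3 ^ d * v := by positivity
  refine ⟨C * 4 ^ 2 + 3 ^ d * v + 1, by linarith, fun δ hδ b x => ?_⟩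
  cases b
  · have := h (4 * δ) (by positivity) x
    simp only [treeNbhd, Bool.false_eq_true, if_false]
    refine this.trans (ENNReal.ofReal_le_ofReal ?_)
    have : 0 ≤ δ ^ 2 := by positivity
    nlinarith
  · have h3 : treeNbhd L δ true x = Metric.closedBall x (3 * δ) := rfl
    rw [h3]
    refine (Measure.restrict_apply_le _ _).trans ?_
    rw [Measure.addHaar_closedBall _ _ (by positivity), finrank_euclideanSpace_fin,
      ← ENNReal.ofReal_toReal (measure_ball_lt_top (μ := volume)
        (x := (0 : EuclideanSpace ℝ (Fin d))) (r := 1)).ne, ← ENNReal.ofReal_mul (by positivity)]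
    refine ENNReal.ofReal_le_ofReal ?_
    simp only [if_true]
    have : 0 ≤ δ ^ d := by positivity
    have h4 : (3 * δ) ^ d * v = 3 ^ d * v * δ ^ d := by ring
    change (3 * δ) ^ d * v ≤ _
    rw [h4]
    nlinarith

end Volume

/-! ### Second moment and variance of the crossing number -/

section Moments

variable {d : ℕ} {L : Submodule ℝ (EuclideanSpace ℝ (Fin d))} {δ : ℝ}

theorem pi_smul_const {ι E : Type*} [Fintype ι] [MeasurableSpace E] (ν : Measure E)
    [IsFiniteMeasure ν] {c : ℝ≥0∞} (hc : c ≠ ∞) :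
    (Measure.pi fun _ : ι => c • ν) = c ^ Fintype.card ι • Measure.pi fun _ : ι => ν := by
  have : IsFiniteMeasure (c • ν) := ν.smul_finite hc
  refine Measure.pi_eq fun s _ => ?_
  simp [Finset.prod_mul_distrib]

theorem measurableSet_doubleCrossingSet : MeasurableSet (doubleCrossingSet L δ) := by
  have h1 : Measurable fun r : Fin 4 ⊕ Fin 4 → EuclideanSpace ℝ (Fin d) => r ∘ Sum.inl :=
    measurable_pi_lambda _ fun i => measurable_pi_apply _
  have h2 : Measurable fun r : Fin 4 ⊕ Fin 4 → EuclideanSpace ℝ (Fin d) => r ∘ Sum.inr :=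
    measurable_pi_lambda _ fun i => measurable_pi_apply _
  exact (h1 isClosed_crossingSet.measurableSet).inter (h2 isClosed_crossingSet.measurableSet)

theorem pi_doubleCrossingSet (μ : Measure (EuclideanSpace ℝ (Fin d))) [IsFiniteMeasure μ] :
    (Measure.pi fun _ : Fin 4 ⊕ Fin 4 => μ) (doubleCrossingSet L δ) =
      (Measure.pi fun _ : Fin 4 => μ) (crossingSet L δ) ^ 2 := by
  have h := (measurePreserving_sumPiEquivProdPi
    (X := fun _ : Fin 4 ⊕ Fin 4 => EuclideanSpace ℝ (Fin d)) fun _ => μ).measure_preimage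
    (isClosed_crossingSet (L := L) (δ := δ) |>.measurableSet.prod
      (isClosed_crossingSet (L := L) (δ := δ)).measurableSet).nullMeasurableSet
  rw [Measure.prod_prod] at h
  rw [sq, ← h]
  rfl

theorem crossingMeasure_univ (V : Set (EuclideanSpace ℝ (Fin d))) :
    crossingMeasure L δ V univ =
      8⁻¹ * ((distinctTuples V (crossingSet L δ)).encard : ℝ≥0∞) := by
  rw [crossingMeasure, Measure.smul_apply, Measure.sum_apply _ MeasurableSet.univ, smul_eq_mul,
    ← crossingQuadruples_eq, ← ENNReal.tsum_set_one]
  simp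

variable {Ω : Type*} [MeasurableSpace Ω] {P : Measure Ω}
  {η : Ω → Measure (EuclideanSpace ℝ (Fin d))} {μ : Measure (EuclideanSpace ℝ (Fin d))}

/-- The second moment of the number of crossing quadruples. -/
theorem IsPoissonPointProcess.lintegral_crossings_sq [IsFiniteMeasure μ] [NullSingletonClass μ]
    [μ.OuterRegular] (h : IsPoissonPointProcess P η μ) :
    ∫⁻ ω, ((distinctTuples (pointSet (η ω)) (crossingSet L δ)).encard : ℝ≥0∞) ^ 2 ∂P =
      (Measure.pi fun _ : Fin 4 => μ) (crossingSet L δ) ^ 2 +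
      8 * (Measure.pi fun _ : Fin 4 => μ) (crossingSet L δ) +
      ∫⁻ ω, ((overlappingPairs L δ (pointSet (η ω))).encard : ℝ≥0∞) ∂P := by
  obtain ⟨h1, h2⟩ := h.aemeasurable_and_lintegral_distinctTuples
    (isClosed_crossingSet (L := L) (δ := δ)).measurableSet
  obtain ⟨h3, h4⟩ := h.aemeasurable_and_lintegral_distinctTuples
    (measurableSet_doubleCrossingSet (L := L) (δ := δ))
  have : ∀ ω, ((distinctTuples (pointSet (η ω)) (crossingSet L δ)).encard : ℝ≥0∞) ^ 2 =
      ((distinctTuples (pointSet (η ω)) (doubleCrossingSet L δ)).encard : ℝ≥0∞) +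
      8 * ((distinctTuples (pointSet (η ω)) (crossingSet L δ)).encard : ℝ≥0∞) +
      ((overlappingPairs L δ (pointSet (η ω))).encard : ℝ≥0∞) := by
    intro ω
    rw [← ENat.toENNReal_pow, encard_sq_distinctTuples_crossingSet]
    simp
  simp_rw [this]
  rw [lintegral_add_left' (f := fun ω =>
      ((distinctTuples (pointSet (η ω)) (doubleCrossingSet L δ)).encard : ℝ≥0∞) +
      8 * ((distinctTuples (pointSet (η ω)) (crossingSet L δ)).encard : ℝ≥0∞))
    (h3.add (h1.const_mul 8)), lintegral_add_left' h3,
    lintegral_const_mul'' _ h1, h2, h4, pi_doubleCrossingSet]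

theorem toENNReal_sum {α : Type*} (s : Finset α) (f : α → ℕ∞) :
    ((∑ a ∈ s, f a : ℕ∞) : ℝ≥0∞) = ∑ a ∈ s, (f a : ℝ≥0∞) :=
  map_sum ENat.toENNRealRingHom f s

theorem IsPoissonPointProcess.lintegral_overlappingPairs_le [IsFiniteMeasure μ]
    [NullSingletonClass μ] [μ.OuterRegular] (h : IsPoissonPointProcess P η μ) (hδ : 0 ≤ δ) :
    ∫⁻ ω, ((overlappingPairs L δ (pointSet (η ω))).encard : ℝ≥0∞) ∂P ≤
      ∑ c ∈ sparseTrees,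
        (Measure.pi fun _ : Fin (c.1 + 1) => μ) (treeSet L δ c.2.1 c.2.2.1) := by
  have hm := fun c : TreeCode => h.aemeasurable_and_lintegral_distinctTuples
    (measurableSet_treeSet (L := L) (δ := δ) c.2.1 c.2.2.1)
  calc ∫⁻ ω, ((overlappingPairs L δ (pointSet (η ω))).encard : ℝ≥0∞) ∂P
      ≤ ∫⁻ ω, ∑ c ∈ sparseTrees,
        ((distinctTuples (pointSet (η ω)) (treeSet L δ c.2.1 c.2.2.1)).encard : ℝ≥0∞) ∂P := by
        refine lintegral_mono fun ω => ?_
        have := ENat.toENNReal_mono (encard_overlappingPairs_le L (pointSet (η ω)) hδ)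
        rwa [toENNReal_sum] at this
    _ = _ := by
        rw [lintegral_finsetSum' _ fun c _ => (hm c).1]
        exact Finset.sum_congr rfl fun c _ => (hm c).2

/-- In the regime `t² δ^(d+1) = O(1)`, the expected number of sparse trees is `O(δ)`. -/
theorem sparse_weight_le (hd : 3 ≤ d) {t A : ℝ} (ht : 0 < t) (hδ : 0 < δ) (hδ1 : δ ≤ 1)
    (hA : 1 ≤ A) (hs : t ^ 2 * δ ^ (d + 1) ≤ A) {n c : ℕ}
    (hnc : (n, c) ∈ ({(3, 0), (4, 1), (5, 2), (5, 1), (6, 2)} : Finset (ℕ × ℕ))) :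
    t ^ (n + 1) * δ ^ (d * (n - c) + 2 * c) ≤ A ^ 4 * δ := by
  obtain ⟨e, rfl⟩ := Nat.exists_eq_add_of_le' hd
  set s := t ^ 2 * δ ^ (e + 3 + 1) with hs_def
  set u := t * δ ^ (e + 3) with hu_def
  have hs0 : 0 ≤ s := by positivity
  have hu0 : 0 ≤ u := by positivity
  have hp : ∀ k : ℕ, δ ^ k ≤ 1 := fun k => pow_le_one₀ hδ.le hδ1
  -- The expected degree `u` of a vertex is `O(δ)`, as `u² = s δ^(d-1)` and `d ≥ 3`.
  have hu : u ≤ A * δ := by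
    have h1 : u ^ 2 ≤ (A * δ) ^ 2 := by
      calc u ^ 2 = s * δ ^ e * δ ^ 2 := by rw [hu_def, hs_def]; ring
        _ ≤ A * 1 * δ ^ 2 := by
          gcongr
          exact hp e
        _ ≤ A ^ 2 * δ ^ 2 := by
          gcongr
          nlinarith
        _ = (A * δ) ^ 2 := by ring
    exact le_of_sq_le_sq h1 (by positivity)
  have hA2 : A ^ 2 ≤ A ^ 4 := pow_le_pow_right₀ hA (by norm_num)
  have hA3 : A ^ 3 ≤ A ^ 4 := pow_le_pow_right₀ hA (by norm_num)
  simp only [Finset.mem_insert, Finset.mem_singleton, Prod.mk.injEq] at hnc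
  rcases hnc with ⟨rfl, rfl⟩ | ⟨rfl, rfl⟩ | ⟨rfl, rfl⟩ | ⟨rfl, rfl⟩ | ⟨rfl, rfl⟩
  · calc t ^ (3 + 1) * δ ^ ((e + 3) * (3 - 0) + 2 * 0) = s ^ 2 * δ ^ e * δ := by
          rw [hs_def]; norm_num; ring
      _ ≤ A ^ 2 * 1 * δ := by gcongr; exact hp e
      _ ≤ A ^ 4 * δ := by rw [mul_one]; gcongr
  · calc t ^ (4 + 1) * δ ^ ((e + 3) * (4 - 1) + 2 * 1) = s ^ 2 * u := by
          rw [hs_def, hu_def]; norm_num; ring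
      _ ≤ A ^ 2 * (A * δ) := by gcongr
      _ = A ^ 3 * δ := by ring
      _ ≤ A ^ 4 * δ := by gcongr
  · calc t ^ (5 + 1) * δ ^ ((e + 3) * (5 - 2) + 2 * 2) = s ^ 3 * δ := by
          rw [hs_def]; norm_num; ring
      _ ≤ A ^ 3 * δ := by gcongr
      _ ≤ A ^ 4 * δ := by gcongr
  · calc t ^ (5 + 1) * δ ^ ((e + 3) * (5 - 1) + 2 * 1) = s ^ 2 * u ^ 2 := by
          rw [hs_def, hu_def]; norm_num; ring
      _ ≤ A ^ 2 * (A * δ) ^ 2 := by gcongr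
      _ = A ^ 4 * (δ * δ) := by ring
      _ ≤ A ^ 4 * (δ * 1) := by gcongr
      _ = A ^ 4 * δ := by ring
  · calc t ^ (6 + 1) * δ ^ ((e + 3) * (6 - 2) + 2 * 2) = s ^ 3 * u * δ := by
          rw [hs_def, hu_def]; norm_num; ring
      _ ≤ A ^ 3 * (A * δ) * δ := by gcongr
      _ = A ^ 4 * (δ * δ) := by ring
      _ ≤ A ^ 4 * (δ * 1) := by gcongr
      _ = A ^ 4 * δ := by ring

theorem prod_ofReal_treeWeight {C : ℝ} (hC : 0 ≤ C) (hδ : 0 ≤ δ) {n : ℕ} (ball : Fin n → Bool) :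
    ∏ i, ENNReal.ofReal (C * δ ^ (if ball i then d else 2)) =
      ENNReal.ofReal (C ^ n * δ ^ (d * (n - (Finset.univ.filter fun i => ball i = false).card) +
        2 * (Finset.univ.filter fun i => ball i = false).card)) := by
  rw [← ENNReal.ofReal_prod_of_nonneg fun i _ => by positivity]
  congr 1
  rw [Finset.prod_mul_distrib, Finset.prod_const, Finset.card_univ, Fintype.card_fin,
    Finset.prod_pow_eq_pow_sum, Finset.sum_ite, Finset.sum_const, Finset.sum_const]
  have h := Finset.card_filter_add_card_filter_not (s := (Finset.univ : Finset (Fin n)))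
    (fun i => ball i = true)
  simp only [Finset.card_univ, Fintype.card_fin, Bool.not_eq_true] at h
  simp only [Bool.not_eq_true, smul_eq_mul]
  congr 2
  rw [mul_comm d, mul_comm 2]
  congr 2
  lia

/-- The overlapping pairs of distinct crossings contribute `O(δ)` to the second moment. -/
theorem IsPoissonPointProcess.lintegral_overlappingPairs_le_ofReal (hd : 3 ≤ d)
    {ν : Measure (EuclideanSpace ℝ (Fin d))} [IsProbabilityMeasure ν] [NullSingletonClass ν]
    {t C A : ℝ} (ht : 0 < t) (h : IsPoissonPointProcess P η (ENNReal.ofReal t • ν))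
    (hδ : 0 < δ) (hC : 1 ≤ C)
    (hν : ∀ (b : Bool) x, ν (treeNbhd L δ b x) ≤ ENNReal.ofReal (C * δ ^ (if b then d else 2)))
    (hδ1 : δ ≤ 1) (hA : 1 ≤ A) (hs : t ^ 2 * δ ^ (d + 1) ≤ A) :
    ∫⁻ ω, ((overlappingPairs L δ (pointSet (η ω))).encard : ℝ≥0∞) ∂P ≤
      ENNReal.ofReal (sparseTrees.card * (C ^ 6 * A ^ 4) * δ) := by
  have hfin : IsFiniteMeasure (ENNReal.ofReal t • ν) := ν.smul_finite ENNReal.ofReal_ne_top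
  have hns : NullSingletonClass (ENNReal.ofReal t • ν) := ⟨fun x => by simp⟩
  refine (h.lintegral_overlappingPairs_le hδ.le).trans ?_
  have hterm : ∀ c ∈ sparseTrees,
      (Measure.pi fun _ : Fin (c.1 + 1) => ENNReal.ofReal t • ν) (treeSet L δ c.2.1 c.2.2.1) ≤
      ENNReal.ofReal (C ^ 6 * A ^ 4 * δ) := by
    intro c hc
    obtain ⟨hpar, hnc⟩ := mem_sparseTrees.1 hc
    rw [pi_smul_const ν ENNReal.ofReal_ne_top, Measure.smul_apply, smul_eq_mul, Fintype.card_fin]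
    refine (mul_le_mul_right (pi_treeSet_le ν hν hpar c.2.2.1) _).trans ?_
    rw [prod_ofReal_treeWeight (by linarith) hδ.le, ← ENNReal.ofReal_pow ht.le,
      ← ENNReal.ofReal_mul (by positivity)]
    refine ENNReal.ofReal_le_ofReal ?_
    have h1 := sparse_weight_le hd ht hδ hδ1 hA hs hnc
    have h2 : C ^ (c.1 : ℕ) ≤ C ^ 6 := pow_le_pow_right₀ hC (by lia)
    rw [mul_left_comm, mul_assoc (C ^ 6)]
    exact mul_le_mul h2 h1 (by positivity) (by positivity)
  refine (Finset.sum_le_card_nsmul _ _ _ hterm).trans ?_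
  rw [nsmul_eq_mul, mul_assoc (sparseTrees.card : ℝ),
    ENNReal.ofReal_mul (Nat.cast_nonneg _), ENNReal.ofReal_natCast]

/-- The crossing number is square integrable, and its variance exceeds its mean by `1 / 64` times
the expected number of overlapping pairs. -/
theorem IsPoissonPointProcess.variance_crossings [IsProbabilityMeasure P] [IsFiniteMeasure μ]
    [NullSingletonClass μ] [μ.OuterRegular] (h : IsPoissonPointProcess P η μ) (hδ : 0 ≤ δ)
    {X : Ω → ℝ≥0∞} (hX : ∀ ω, X ω = crossingMeasure L δ (pointSet (η ω)) univ) :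
    (∀ᵐ ω ∂P, X ω ≠ ∞) ∧ MemLp (fun ω => (X ω).toReal) 2 P ∧
      variance (fun ω => (X ω).toReal) P - ∫ ω, (X ω).toReal ∂P =
        (∫⁻ ω, ((overlappingPairs L δ (pointSet (η ω))).encard : ℝ≥0∞) ∂P).toReal / 64 := by
  classical
  set N : Ω → ℝ≥0∞ := fun ω => ((distinctTuples (pointSet (η ω)) (crossingSet L δ)).encard : ℝ≥0∞)
    with hN
  obtain ⟨hm, hmean⟩ := h.aemeasurable_and_lintegral_distinctTuples
    (isClosed_crossingSet (L := L) (δ := δ)).measurableSet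
  have hsq := h.lintegral_crossings_sq (L := L) (δ := δ)
  set m := (Measure.pi fun _ : Fin 4 => μ) (crossingSet L δ) with hm_def
  set r := ∫⁻ ω, ((overlappingPairs L δ (pointSet (η ω))).encard : ℝ≥0∞) ∂P with hr_def
  have hm_top : m ≠ ∞ := measure_ne_top _ _
  have hr_top : r ≠ ∞ := by
    refine ne_top_of_le_ne_top ?_ (h.lintegral_overlappingPairs_le hδ)
    exact ENNReal.sum_ne_top.2 fun c _ => measure_ne_top _ _
  have hsq_top : ∫⁻ ω, N ω ^ 2 ∂P ≠ ∞ := by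
    rw [hsq]
    finiteness
  have hXN : ∀ ω, X ω = 8⁻¹ * N ω := fun ω => by rw [hX, crossingMeasure_univ]
  have hreal : ∀ ω, (X ω).toReal = (N ω).toReal / 8 := by
    intro ω
    rw [hXN, ENNReal.toReal_mul, ENNReal.toReal_inv]
    norm_num
    ring
  have hNfin : ∀ᵐ ω ∂P, N ω < ∞ := ae_lt_top' hm (by rw [hmean]; exact hm_top)
  have hNsqfin : ∀ᵐ ω ∂P, N ω ^ 2 < ∞ := by
    filter_upwards [hNfin] with ω hω using ENNReal.pow_lt_top hω
  have hmean' : ∫ ω, (N ω).toReal ∂P = m.toReal := by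
    rw [integral_toReal hm hNfin, hmean]
  have hsq' : ∫ ω, (N ω ^ 2).toReal ∂P = m.toReal ^ 2 + 8 * m.toReal + r.toReal := by
    rw [integral_toReal (hm.pow_const 2) hNsqfin, hsq, ENNReal.toReal_add (by finiteness) hr_top,
      ENNReal.toReal_add (by finiteness) (by finiteness), ENNReal.toReal_pow, ENNReal.toReal_mul]
    rfl
  have hL2 : MemLp (fun ω => (X ω).toReal) 2 P := by
    simp_rw [hreal]
    refine (memLp_two_iff_integrable_sq
      ((hm.ennreal_toReal.div_const 8).aestronglyMeasurable)).2 ?_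
    have := (integrable_toReal_of_lintegral_ne_top (hm.pow_const 2) hsq_top).div_const 64
    refine this.congr (ae_of_all _ fun ω => ?_)
    simp only [ENNReal.toReal_pow]
    ring
  refine ⟨?_, hL2, ?_⟩
  · filter_upwards [hNfin] with ω hω
    rw [hXN]
    finiteness
  · rw [variance_eq_sub hL2]
    have h1 : ∫ ω, (X ω).toReal ∂P = m.toReal / 8 := by
      simp_rw [hreal]
      rw [integral_div, hmean']
    have h2 : ∫ ω, ((fun ω => (X ω).toReal) ^ 2) ω ∂P =
        (m.toReal ^ 2 + 8 * m.toReal + r.toReal) / 64 := by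
      rw [← hsq', ← integral_div]
      congr 1 with ω
      simp only [Pi.pow_apply, hreal, ENNReal.toReal_pow]
      ring
    rw [h1, h2]
    ring

end Moments

theorem mainTheorem5 (d : ℕ) (hd : 3 ≤ d)
    (W : Set (EuclideanSpace ℝ (Fin d))) (hWcompact : IsCompact W) (hWconvex : Convex ℝ W)
    (hWvol : volume W = 1)
    (L : Submodule ℝ (EuclideanSpace ℝ (Fin d))) (hL : Module.finrank ℝ L = 2)
    (Ω : ℝ → Type*) [∀ t, MeasurableSpace (Ω t)]
    (P : ∀ t, Measure (Ω t)) [∀ t, IsProbabilityMeasure (P t)]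
    (η : ∀ t, Ω t → Measure (EuclideanSpace ℝ (Fin d)))
    (hη : ∀ t, 0 < t →
      IsPoissonPointProcess (P t) (η t) (ENNReal.ofReal t • volume.restrict W))
    (δ : ℝ → ℝ) (hδ : ∀ t, 0 < t → 0 < δ t)
    (c : ℝ) (hc : Tendsto (fun t => t ^ 2 * δ t ^ (d + 1)) atTop (𝓝 c))
    (ξ : ∀ t, Ω t → Measure L)
    (hξ : ∀ t ω, ξ t ω = crossingMeasure L (δ t) (pointSet (η t ω))) :
    (∀ t, 0 < t → (∀ᵐ ω ∂(P t), ξ t ω univ ≠ ∞) ∧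
      MemLp (fun ω => (ξ t ω univ).toReal) 2 (P t)) ∧
    (fun t => variance (fun ω => (ξ t ω univ).toReal) (P t) -
      ∫ ω, (ξ t ω univ).toReal ∂(P t)) =O[atTop] δ := by
  have hd0 : NeZero d := ⟨by lia⟩
  have hν : IsProbabilityMeasure (volume.restrict W) := ⟨by rw [Measure.restrict_apply_univ, hWvol]⟩
  have hfin : ∀ t, IsFiniteMeasure (ENNReal.ofReal t • volume.restrict W) :=
    fun t => (volume.restrict W).smul_finite ENNReal.ofReal_ne_top
  have hns : ∀ t, NullSingletonClass (ENNReal.ofReal t • volume.restrict W) :=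
    fun t => ⟨fun x => by simp⟩
  have hvar := fun t (ht : 0 < t) => (hη t ht).variance_crossings (L := L) (hδ t ht).le
    (X := fun ω => ξ t ω univ) (fun ω => by rw [hξ])
  refine ⟨fun t ht => ⟨(hvar t ht).1, (hvar t ht).2.1⟩, ?_⟩
  obtain ⟨C, hC, hνC⟩ := exists_volume_treeNbhd_le hL hWcompact.isBounded
  set A := |c| + 1 with hA_def
  have hA : 1 ≤ A := by simp [hA_def]
  refine IsBigO.of_bound (sparseTrees.card * (C ^ 6 * A ^ 4) / 64) ?_
  have hcA : c < A := (le_abs_self c).trans_lt (by simp [hA_def])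
  filter_upwards [eventually_ge_atTop A, hc.eventually (eventually_lt_nhds hcA)] with t htA hst
  have ht : 0 < t := by linarith
  have hδt := hδ t ht
  have hδ1 : δ t ≤ 1 := by
    have h1 : t ^ 2 * δ t ^ (d + 1) ≤ t ^ 2 * 1 := by nlinarith
    exact (pow_le_one_iff_of_nonneg hδt.le (by lia)).1 (le_of_mul_le_mul_left h1 (by positivity))
  have hr := (hη t ht).lintegral_overlappingPairs_le_ofReal (L := L) hd ht hδt hC
    (hνC (δ t) hδt.le) hδ1 hA hst.le
  rw [(hvar t ht).2.2, Real.norm_of_nonneg (by positivity), Real.norm_of_nonneg hδt.le]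
  have := ENNReal.toReal_le_of_le_ofReal (by positivity) hr
  linarith
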